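/- Let $p$ be a prime, let $F$ be a finite extension of $\mathbb{Q}_p$ with its norm extending the $p$-adic norm, let $L$ be the unramified quadratic field extension of $F$, and let $D$ be a central division algebra of dimension $4$ over $F$; equip $L$ and $D$ with the unique norms $|\cdot|$ extending that of $F$. Let $K$ be a field containing $F$ that is complete with respect to a non-archimedean norm with $|p|=1/p$. Write $\mathcal{O}_L=\{x\in L:|x|\le 1\}$, $\mathcal{O}_D=\{x\in D:|x|\le 1\}$, $k_L=\mathcal{O}_L/\{x\in L: |x|<1\}$, and let $\omega_L:\mathcal{O}_L^\times\to k_L^\times$ be the reduction map. Put $$P^1_L:=\ker\big(N_{L/F}|_{\mathcal{O}_L^\times}\big)\cap\ker(\omega_L)\subseteq\mathcal{O}_L^\times .$$ Let $(\mathcal{O}_D^\times)^{\mathrm{ab}}$ be the quotient of $\mathcal{O}_D^\times$ by its (abstract) commutator subgroup, with the quotient topology, and let $\varrho:\mathcal{O}_D^\times\to(\mathcal{O}_D^\times)^{\mathrm{ab}}$ be the projection. $\mathrm{Hom}$ denotes the group of continuous homomorphisms. The group $D^\times$ acts on $\mathrm{Hom}(\mathcal{O}_D^\times,K^\times)$ by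 $(d\cdot\chi)(x)=\chi(d^{-1}xd)$, and $\mathrm{Gal}(L/F)$ acts on $\mathrm{Hom}(\mathcal{O}_L^\times/P^1_L,K^\times)$ by $(\sigma\cdot\psi)(x)=\psi(\sigma^{-1}(x))$. Then the topological group $(\mathcal{O}_D^\times)^{\mathrm{ab}}$ is profinite, and for every $F$-algebra homomorphism $\iota:L\to D$ the following hold. 1. The map $\varrho\circ\iota$ induces an isomorphism of topological groups $\overline{\varrho\circ\iota}:\mathcal{O}_L^\times/P^1_L\xrightarrow{\ \cong\ }(\mathcal{O}_D^\times)^{\mathrm{ab}}$ (so this is an isomorphism of profinite abelian groups). 2. There is an isomorphism of abelian groups $\overline{\varrho\circ\iota}^{\,*}:\mathrm{Hom}(\mathcal{O}_D^\times,K^\times)\xrightarrow{\ \cong\ }\mathrm{Hom}(\mathcal{O}_L^\times/P^1_L,K^\times)$, given by $\chi\mapsto\big(uP^1_L\mapsto\chi(\iota(u))\big)$. 3. This isomorphism induces a bijection $\mathrm{Hom}(\mathcal{O}_D^\times,K^\times)/D^\times\xrightarrow{\ \cong\ }\mathrm{Hom}(\mathcal{O}_L^\times/P^1_L,K^\times)/\mathrm{Gal}(L/F)$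 on sets of orbits. 4. The bijection in 3 does not depend on the choice of $\iota$. -/

import Mathlib

namespace LocalQuaternion

open Topology

noncomputable section

section ValuationRing

variable (E : Type*) [NormedDivisionRing E] [IsUltrametricDist E]

/-- The valuation ring `O_E = {x ∈ E : |x| ≤ 1}` of a non-archimedean normed division ring. -/
def valRing : Subring E where
  carrier := {x | ‖x‖ ≤ 1}
  mul_mem' {a b} ha hb := by
    have ha' : ‖a‖ ≤ 1 := ha
    have hb' : ‖b‖ ≤ 1 := hb
    change ‖a * b‖ ≤ 1
    rw [norm_mul]
    exact mul_le_one₀ ha' (norm_nonneg b) hb'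
  one_mem' := by simp
  add_mem' {a b} ha hb := (IsUltrametricDist.norm_add_le_max a b).trans (max_le ha hb)
  zero_mem' := by simp
  neg_mem' {a} ha := by simpa using ha

variable {E}

lemma mem_valRing {x : E} : x ∈ valRing E ↔ ‖x‖ ≤ 1 := Iff.rfl

variable {E' : Type*} [NormedDivisionRing E'] [IsUltrametricDist E']

/-- A norm-preserving ring homomorphism `f : E → E'` restricts to a continuous group homomorphism
`O_E^× → O_{E'}^×`. -/
def unitsMap (f : E →+* E') (hf : ∀ x, ‖f x‖ = ‖x‖) : (valRing E)ˣ →ₜ* (valRing E')ˣ where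
  toMonoidHom := Units.map
    (f.restrict (valRing E) (valRing E')
      (fun x hx => mem_valRing.2 ((hf x).trans_le (mem_valRing.1 hx))) : _ →* _)
  continuous_toFun := by
    apply Continuous.units_map
    have hc : Continuous f := (AddMonoidHomClass.isometry_of_norm f hf).continuous
    exact Continuous.subtype_mk (hc.comp continuous_subtype_val) _

lemma coe_unitsMap (f : E →+* E') (hf : ∀ x, ‖f x‖ = ‖x‖) (u : (valRing E)ˣ) :
    ((unitsMap f hf u : valRing E') : E') = f ((u : valRing E) : E) := rfl

lemma unitsVal_injective {u v : (valRing E)ˣ}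
    (h : ((u : valRing E) : E) = ((v : valRing E) : E)) : u = v :=
  Units.ext (Subtype.ext h)

end ValuationRing

section Field

variable (L : Type*) [NormedField L] [IsUltrametricDist L]

/-- The maximal ideal `P_L = {x ∈ O_L : |x| < 1}` of `O_L`. -/
def maxIdeal : Ideal (valRing L) where
  carrier := {x | ‖(x : L)‖ < 1}
  add_mem' {a b} ha hb :=
    (IsUltrametricDist.norm_add_le_max (a : L) (b : L)).trans_lt (max_lt ha hb)
  zero_mem' := by simp
  smul_mem' c {x} hx := by
    have hc : ‖(c : L)‖ ≤ 1 := c.2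
    have hx' : ‖(x : L)‖ < 1 := hx
    change ‖(c : L) * (x : L)‖ < 1
    rw [norm_mul]
    exact mul_lt_one_of_nonneg_of_lt_one_right hc (norm_nonneg _) hx'

/-- The residue field `k_L = O_L / P_L`. -/
abbrev resField : Type _ := valRing L ⧸ maxIdeal L

/-- The reduction map `ω_L : O_L^× → k_L^×`. -/
def unitsReduction : (valRing L)ˣ →* (resField L)ˣ :=
  Units.map (Ideal.Quotient.mk (maxIdeal L) : valRing L →* resField L)

variable (F : Type*) [NormedField F] [NormedAlgebra F L]

/-- The norm map `N_{L/F}` on `O_L^×`. -/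
def unitsNorm : (valRing L)ˣ →* Fˣ :=
  (Units.map (Algebra.norm F : L →* F)).comp (Units.map ((valRing L).subtype : valRing L →* L))

/-- The subgroup `P^1_L = ker N_{L/F} ∩ ker ω_L` of `O_L^×`. -/
def P1 : Subgroup (valRing L)ˣ := (unitsNorm L F).ker ⊓ (unitsReduction L).ker

/-- An algebraic extension `L/F` of non-archimedean local fields is unramified if its ramification
index is one, that is, if `F` and `L` have the same value group (the residue fields are finite, so
the residue extension is automatically separable). -/
def IsUnramified : Prop := ∀ x : L, ∃ a : F, ‖x‖ = ‖a‖

end Field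

section Embedding

variable {F L E : Type*} [NontriviallyNormedField F] [CompleteSpace F]
  [NormedField L] [NormedAlgebra F L] [FiniteDimensional F L]
  [NormedDivisionRing E] [NormedAlgebra F E]

/-- An `F`-algebra homomorphism out of a finite extension `L` of the complete field `F` preserves
the norms. -/
lemma norm_algHom (f : L →ₐ[F] E) (x : L) : ‖f x‖ = ‖x‖ := by
  have key : ∀ y : L, ‖f y‖ ≤ ‖y‖ := by
    intro y
    have hc : Continuous f.toLinearMap := LinearMap.continuous_of_finiteDimensional _
    obtain ⟨C, hC, hb⟩ := (⟨f.toLinearMap, hc⟩ : L →L[F] E).bound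
    by_contra! hlt
    have hy : 0 < ‖y‖ := by
      rcases (norm_nonneg y).eq_or_lt with h | h
      · have : y = 0 := norm_eq_zero.1 h.symm
        simp [this] at hlt
      · exact h
    have h1 : 1 < ‖f y‖ / ‖y‖ := (one_lt_div hy).2 hlt
    obtain ⟨n, hn⟩ := pow_unbounded_of_one_lt C h1
    have h2 : ‖f (y ^ n)‖ ≤ C * ‖y ^ n‖ := hb (y ^ n)
    rw [map_pow, norm_pow, norm_pow, ← div_le_iff₀ (pow_pos hy n), ← div_pow] at h2
    exact absurd h2 (not_le.2 hn)
  refine le_antisymm (key x) ?_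
  by_cases hx : x = 0
  · simp [hx]
  have h := key x⁻¹
  have hfx : f x ≠ 0 := by
    intro h0
    have : f (x * x⁻¹) = 0 := by rw [map_mul, h0, zero_mul]
    rw [mul_inv_cancel₀ hx, map_one] at this
    exact one_ne_zero this
  have hinv : f x⁻¹ = (f x)⁻¹ := by
    apply eq_inv_of_mul_eq_one_left
    rw [← map_mul, inv_mul_cancel₀ hx, map_one]
  rw [hinv, norm_inv, norm_inv] at h
  exact (inv_le_inv₀ (norm_pos_iff.2 hfx) (norm_pos_iff.2 hx)).1 h

variable [IsUltrametricDist L] [IsUltrametricDist E]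

/-- The map `O_L^× → O_E^×` induced by an `F`-algebra homomorphism `L → E`. -/
def unitsEmb (f : L →ₐ[F] E) : (valRing L)ˣ →ₜ* (valRing E)ˣ :=
  unitsMap (f : L →+* E) (norm_algHom f)

end Embedding

section Actions

/-- Conjugation `x ↦ d x d⁻¹` by `d ∈ D^×`, as a continuous endomorphism of `O_D^×`. -/
def unitsConj {D : Type*} [NormedDivisionRing D] [IsUltrametricDist D] (d : Dˣ) :
    (valRing D)ˣ →ₜ* (valRing D)ˣ :=
  unitsMap
    { toFun := fun x => (d : D) * x * ((d⁻¹ : Dˣ) : D)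
      map_one' := by simp
      map_mul' := fun x y => by simp [mul_assoc]
      map_zero' := by simp
      map_add' := fun x y => by rw [mul_add, add_mul] }
    (fun x => by
      have hd : ‖(d : D)‖ ≠ 0 := norm_ne_zero_iff.2 d.ne_zero
      change ‖(d : D) * x * ((d⁻¹ : Dˣ) : D)‖ = ‖x‖
      rw [norm_mul, norm_mul, Units.val_inv_eq_inv_val, norm_inv]
      field_simp)

/-- The action of `D^×` on `Hom(O_D^×, M)` given by `(d • χ)(x) = χ(d⁻¹ x d)`. -/
instance conjAction (D M : Type*) [NormedDivisionRing D] [IsUltrametricDist D]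
    [Monoid M] [TopologicalSpace M] : MulAction Dˣ ((valRing D)ˣ →ₜ* M) where
  smul d χ := χ.comp (unitsConj d⁻¹)
  one_smul χ := by
    refine ContinuousMonoidHom.ext fun x => congrArg χ (unitsVal_injective ?_)
    simp [unitsConj, coe_unitsMap]
  mul_smul d d' χ := by
    refine ContinuousMonoidHom.ext fun x => congrArg χ (unitsVal_injective ?_)
    simp [unitsConj, coe_unitsMap, mul_assoc]

variable {F L : Type*} [NontriviallyNormedField F] [CompleteSpace F]
  [NormedField L] [NormedAlgebra F L] [FiniteDimensional F L] [IsUltrametricDist L]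

lemma P1_le_comap (σ : L ≃ₐ[F] L) :
    P1 L F ≤ (P1 L F).comap (unitsEmb (σ : L →ₐ[F] L)).toMonoidHom := by
  intro u hu
  have h1 : unitsNorm L F u = 1 := hu.1
  have h2 : unitsReduction L u = 1 := hu.2
  refine Subgroup.mem_comap.2 (Subgroup.mem_inf.2 ⟨MonoidHom.mem_ker.2 ?_, MonoidHom.mem_ker.2 ?_⟩)
  · rw [← h1]
    apply Units.ext
    exact Algebra.norm_eq_of_algEquiv σ _
  · have h3 : ‖((u : valRing L) : L) - 1‖ < 1 :=
      Ideal.Quotient.eq.1 (congrArg Units.val h2)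
    refine Units.ext (Ideal.Quotient.eq.2 ?_)
    change ‖σ ((u : valRing L) : L) - 1‖ < 1
    have h4 := norm_algHom (σ : L →ₐ[F] L) (((u : valRing L) : L) - 1)
    rw [map_sub, map_one] at h4
    exact h4.trans_lt h3

/-- The automorphism of `O_L^× / P^1_L` induced by `σ ∈ Gal(L/F)`. -/
def quotGal (σ : L ≃ₐ[F] L) : ((valRing L)ˣ ⧸ P1 L F) →ₜ* ((valRing L)ˣ ⧸ P1 L F) where
  toMonoidHom := QuotientGroup.map (P1 L F) (P1 L F) (unitsEmb (σ : L →ₐ[F] L)).toMonoidHom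
    (P1_le_comap σ)
  continuous_toFun := by
    refine continuous_quot_lift _ ?_
    exact continuous_quot_mk.comp (unitsEmb (σ : L →ₐ[F] L)).continuous_toFun

/-- The action of `Gal(L/F)` on `Hom(O_L^× / P^1_L, M)` given by `(σ • ψ)(x) = ψ(σ⁻¹ x)`. -/
instance galAction (F L M : Type*) [NontriviallyNormedField F] [CompleteSpace F]
    [NormedField L] [NormedAlgebra F L] [FiniteDimensional F L] [IsUltrametricDist L]
    [Monoid M] [TopologicalSpace M] :
    MulAction (L ≃ₐ[F] L) (((valRing L)ˣ ⧸ P1 L F) →ₜ* M) where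
  smul σ ψ := ψ.comp (quotGal σ⁻¹)
  one_smul ψ := by
    refine ContinuousMonoidHom.ext fun x => congrArg ψ ?_
    induction x using QuotientGroup.induction_on with
    | H u => exact congrArg _ (unitsVal_injective rfl)
  mul_smul σ τ ψ := by
    refine ContinuousMonoidHom.ext fun x => congrArg ψ ?_
    induction x using QuotientGroup.induction_on with
    | H u =>
      refine congrArg _ (unitsVal_injective ?_)
      change (σ * τ)⁻¹ _ = τ⁻¹ (σ⁻¹ _)
      rw [mul_inv_rev]
      rfl

end Actions

/-- The abelianization `G / [G, G]`, with the quotient topology. -/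
abbrev Ab (G : Type*) [Group G] : Type _ := G ⧸ commutator G

end

end LocalQuaternion

/-! Everything rests on one identification: the commutator subgroup of O_D^× consists of the units x
with Nrd(x) = 1 and |x − 1| < 1 (`Frame.inComm_iff`). On O_L^× these two conditions cut out P^1_L,
which gives injectivity. They are closed conditions, so the abelianization is Hausdorff, and a
continuous bijection onto it from a compact group is a homeomorphism.

Commutators satisfy both conditions because the reduced norm and the reduction map are
multiplicative with commutative targets, the residue ring of D being a finite domain. For the
converse, write D = L ⊕ Lϖ with ϖ² a uniformizer of F and ϖx = σ(x)ϖ (`nonempty_frame`), and fix a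
unit l of L with l − σ(l) a unit (`exists_norm_sub_eq_one`). Commutators of l with 1 + sϖ realise
every possible ratio of the two coordinates of a unit, so O_D^× is generated by O_L^× and
commutators (`Frame.exists_eq_ι_mul`). An element of P^1_L, multiplied by a suitable commutator,
becomes a y for which some unit A of L has the same trace and norm as Ay. Then A and Ay are
conjugate by a unit, and y is a commutator (`Frame.inComm_of_norm_trace_eq`,
`Frame.inComm_of_norm_eq_one`).

Characters with commutative values factor through the abelianization. Every d ∈ D^× is an element
inducing 1 or σ on ι(L) times a unit of O_D, and such a unit acts trivially on characters; by
Skolem–Noether every automorphism of L is induced. Two embeddings of L are conjugate, so the orbit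
bijection does not depend on ι. That an embedding exists at all follows from the residue field of D
being larger than that of F, together with Hensel's lemma (`nonempty_algHom`). -/

namespace LocalQuaternion

open Topology
open scoped commutatorElement

/-! ### Residue rings of locally compact ultrametric division rings -/

section Residue

variable {E : Type*} [NormedDivisionRing E]

lemma norm_mul_lt_one {x y : E} (hx : ‖x‖ ≤ 1) (hy : ‖y‖ < 1) : ‖x * y‖ < 1 := by
  rw [norm_mul]
  exact mul_lt_one_of_nonneg_of_lt_one_right hx (norm_nonneg _) hy

lemma norm_mul_lt_one_of_lt_of_le {x y : E} (hx : ‖x‖ < 1) (hy : ‖y‖ ≤ 1) : ‖x * y‖ < 1 := by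
  rw [norm_mul]
  exact mul_lt_one_of_nonneg_of_lt_one_left (norm_nonneg _) hx hy

lemma norm_mul_le_one {x y : E} (hx : ‖x‖ ≤ 1) (hy : ‖y‖ ≤ 1) : ‖x * y‖ ≤ 1 := by
  rw [norm_mul]
  exact mul_le_one₀ hx (norm_nonneg _) hy

variable [IsUltrametricDist E]

lemma norm_sub_le_max_norm (x y : E) : ‖x - y‖ ≤ max ‖x‖ ‖y‖ := by
  simpa [sub_eq_add_neg] using IsUltrametricDist.norm_add_le_max x (-y)

lemma norm_add_lt {x y : E} {r : ℝ} (hx : ‖x‖ < r) (hy : ‖y‖ < r) : ‖x + y‖ < r :=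
  (IsUltrametricDist.norm_add_le_max x y).trans_lt (max_lt hx hy)

lemma norm_add_le_of_le_of_le {x y : E} {r : ℝ} (hx : ‖x‖ ≤ r) (hy : ‖y‖ ≤ r) : ‖x + y‖ ≤ r :=
  (IsUltrametricDist.norm_add_le_max x y).trans (max_le hx hy)

lemma norm_sub_lt {x y : E} {r : ℝ} (hx : ‖x‖ < r) (hy : ‖y‖ < r) : ‖x - y‖ < r :=
  (norm_sub_le_max_norm x y).trans_lt (max_lt hx hy)

lemma norm_sub_le_of_le {x y : E} {r : ℝ} (hx : ‖x‖ ≤ r) (hy : ‖y‖ ≤ r) : ‖x - y‖ ≤ r :=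
  (norm_sub_le_max_norm x y).trans (max_le hx hy)

/-- Two elements at distance less than the norm of the first have the same norm. -/
lemma norm_eq_of_norm_sub_lt {x y : E} (h : ‖x - y‖ < ‖x‖) : ‖y‖ = ‖x‖ := by
  refine le_antisymm ?_ ?_
  · have := norm_sub_le_of_le le_rfl h.le
    simpa using this
  · by_contra! hlt
    have := norm_add_lt h hlt
    simp at this

/-- In a locally compact ultrametric normed division ring, the norm attains its maximum on the
nonzero elements of the open unit ball. -/
lemma exists_uniformizer [ProperSpace E] (h : ∃ x : E, x ≠ 0 ∧ ‖x‖ < 1) :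
    ∃ ϖ : E, ϖ ≠ 0 ∧ ‖ϖ‖ < 1 ∧ ∀ x : E, ‖x‖ < 1 → ‖x‖ ≤ ‖ϖ‖ := by
  have hc : IsCompact (Metric.ball (0 : E) 1) :=
    Metric.isCompact_of_isClosed_isBounded (IsUltrametricDist.isClosed_ball 0 1)
      Metric.isBounded_ball
  obtain ⟨ϖ, hϖ, hmax⟩ := hc.exists_isMaxOn ⟨0, by simp⟩ continuous_norm.continuousOn
  obtain ⟨x, hx0, hx⟩ := h
  have hm : ∀ y : E, ‖y‖ < 1 → ‖y‖ ≤ ‖ϖ‖ := fun y hy => hmax (by simpa using hy)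
  refine ⟨ϖ, ?_, by simpa using hϖ, hm⟩
  rintro rfl
  have := hm x hx
  simp [hx0] at this

instance compactSpace_valRing [ProperSpace E] : CompactSpace (valRing E) := by
  refine isCompact_iff_compactSpace.1 (?_ : IsCompact (valRing E : Set E))
  convert isCompact_closedBall (0 : E) 1
  ext x
  simp [mem_valRing]

variable (E) in
/-- The maximal ideal of the valuation ring, as a two-sided ideal. -/
def residueIdeal : Ideal (valRing E) where
  carrier := {x | ‖(x : E)‖ < 1}
  add_mem' {a b} ha hb := norm_add_lt ha hb
  zero_mem' := by simp
  smul_mem' c {x} hx := norm_mul_lt_one c.2 hx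

lemma mem_residueIdeal {x : valRing E} : x ∈ residueIdeal E ↔ ‖(x : E)‖ < 1 := Iff.rfl

instance : (residueIdeal E).IsTwoSided := ⟨fun b ha => norm_mul_lt_one_of_lt_of_le ha b.2⟩

variable (E) in
/-- The residue ring of a non-archimedean normed division ring. -/
abbrev ResidueRing : Type _ := valRing E ⧸ residueIdeal E

instance [ProperSpace E] : Finite (ResidueRing E) := by
  refine AddSubgroup.quotient_finite_of_isOpen (residueIdeal E).toAddSubgroup ?_
  exact isOpen_lt (continuous_norm.comp continuous_subtype_val) continuous_const

lemma residue_eq_zero_iff {x : valRing E} :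
    Ideal.Quotient.mk (residueIdeal E) x = 0 ↔ ‖(x : E)‖ < 1 := by
  rw [Ideal.Quotient.eq_zero_iff_mem, mem_residueIdeal]

instance : Nontrivial (ResidueRing E) :=
  Ideal.Quotient.nontrivial_iff.2 ((Ideal.ne_top_iff_one _).2 (by simp [mem_residueIdeal]))

instance : NoZeroDivisors (ResidueRing E) where
  eq_zero_or_eq_zero_of_mul_eq_zero {a b} h := by
    obtain ⟨a, rfl⟩ := Ideal.Quotient.mk_surjective a
    obtain ⟨b, rfl⟩ := Ideal.Quotient.mk_surjective b
    rw [← map_mul, residue_eq_zero_iff] at h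
    rw [residue_eq_zero_iff, residue_eq_zero_iff]
    by_contra! hc
    have h1 : ‖(a : E)‖ * ‖(b : E)‖ < 1 := by simpa using h
    nlinarith [hc.1, hc.2]

/-- Compactness makes the residue ring a finite domain, so Wedderburn's little theorem gives
commutativity even when `E` is not commutative. -/
lemma isField_residueRing [ProperSpace E] : IsField (ResidueRing E) :=
  have : IsDomain (ResidueRing E) := NoZeroDivisors.to_isDomain _
  Finite.isDomain_to_isField _

/-- The residue ring is commutative. -/
lemma norm_commutator_lt_one [ProperSpace E] {x y : E} (hx : ‖x‖ ≤ 1) (hy : ‖y‖ ≤ 1) :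
    ‖x * y - y * x‖ < 1 := by
  have h := isField_residueRing (E := E).mul_comm
    (Ideal.Quotient.mk _ ⟨x, hx⟩) (Ideal.Quotient.mk _ ⟨y, hy⟩)
  rw [← sub_eq_zero, ← map_mul, ← map_mul, ← map_sub, residue_eq_zero_iff] at h
  exact h

lemma norm_pow_card_sub_lt_one [ProperSpace E] {x : E} (hx : ‖x‖ ≤ 1) :
    ‖x ^ Nat.card (ResidueRing E) - x‖ < 1 := by
  let := isField_residueRing (E := E).toField
  let := Fintype.ofFinite (ResidueRing E)
  have h := FiniteField.pow_card (Ideal.Quotient.mk (residueIdeal E) ⟨x, hx⟩)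
  rw [← Nat.card_eq_fintype_card] at h
  have h' : Ideal.Quotient.mk (residueIdeal E)
      ((⟨x, hx⟩ : valRing E) ^ Nat.card (ResidueRing E) - ⟨x, hx⟩) = 0 := by
    rw [map_sub, map_pow, sub_eq_zero]
    exact h
  rw [residue_eq_zero_iff] at h'
  simpa using h'

lemma even_card_residueRing [ProperSpace E] (h2 : ‖(2 : E)‖ < 1) :
    Even (Nat.card (ResidueRing E)) := by
  have h : (2 : ℕ) • (1 : ResidueRing E) = 0 := by
    rw [← map_one (Ideal.Quotient.mk (residueIdeal E)), ← map_nsmul, residue_eq_zero_iff]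
    rw [nsmul_eq_mul, mul_one, Nat.cast_ofNat]
    exact h2
  have : addOrderOf (1 : ResidueRing E) = 2 := addOrderOf_eq_prime h one_ne_zero
  rw [even_iff_two_dvd, ← this]
  exact addOrderOf_dvd_natCard _

end Residue

/-! ### Unramified quadratic extensions -/

section Quadratic

lemma exists_involution {F L : Type*} [Field F] [Field L] [Algebra F L] [FiniteDimensional F L]
    [IsGalois F L] (hL : Module.finrank F L = 2) :
    ∃ σ : L ≃ₐ[F] L, (∃ x, σ x ≠ x) ∧ (∀ x, σ (σ x) = x) ∧
      (∀ x, σ x = x → ∃ f, algebraMap F L f = x) ∧ (∀ τ : L ≃ₐ[F] L, τ = 1 ∨ τ = σ) ∧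
      ∀ x, algebraMap F L (Algebra.norm F x) = x * σ x := by
  have hcard : Nat.card (L ≃ₐ[F] L) = 2 := by rw [IsGalois.card_aut_eq_finrank, hL]
  obtain ⟨σ, hσ, huniq⟩ := (Nat.card_eq_two_iff' (1 : L ≃ₐ[F] L)).1 hcard
  have hall : ∀ τ : L ≃ₐ[F] L, τ = 1 ∨ τ = σ := fun τ => by
    by_cases h : τ = 1
    · exact Or.inl h
    · exact Or.inr (huniq τ h)
  have hinv : σ * σ = 1 := by
    rcases hall (σ * σ) with h | h
    · exact h
    · exact absurd (mul_eq_left.1 h) hσ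
  refine ⟨σ, ?_, fun x => DFunLike.congr_fun hinv x, fun x hx => ?_, hall, fun x => ?_⟩
  · by_contra! h
    exact hσ (AlgEquiv.ext h)
  · refine IsGalois.mem_range_algebraMap_iff_fixed x |>.2 fun τ => ?_
    rcases hall τ with rfl | rfl
    · rfl
    · exact hx
  · rw [Algebra.norm_eq_prod_automorphisms]
    classical
    have : (Finset.univ : Finset (L ≃ₐ[F] L)) = {1, σ} := by
      ext τ
      simpa using hall τ
    rw [this, Finset.prod_pair (Ne.symm hσ)]
    rfl

/-- A point of `E` has a closest point in the base field. -/
lemma exists_closest {F E : Type*} [NontriviallyNormedField F] [CompleteSpace F]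
    [NormedDivisionRing E] [NormedAlgebra F E] [ProperSpace E] (x : E) :
    ∃ f : F, ∀ g : F, ‖x - algebraMap F E f‖ ≤ ‖x - algebraMap F E g‖ := by
  have hcl : IsClosed (LinearMap.range (Algebra.linearMap F E) : Set E) :=
    Submodule.closed_of_finiteDimensional _
  obtain ⟨y, ⟨f, rfl⟩, hy⟩ := hcl.exists_infDist_eq_dist ⟨0, Submodule.zero_mem _⟩ x
  refine ⟨f, fun g => ?_⟩
  rw [← dist_eq_norm, ← dist_eq_norm]
  exact hy ▸ Metric.infDist_le_dist_of_mem ⟨g, rfl⟩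

lemma norm_pow_sub_pow_lt_one {E : Type*} [NormedField E] [IsUltrametricDist E] {x y : E}
    (hx : ‖x‖ ≤ 1) (hy : ‖y‖ ≤ 1) (h : ‖x - y‖ < 1) (m : ℕ) : ‖x ^ m - y ^ m‖ < 1 := by
  induction m with
  | zero => simp
  | succ m ih =>
    have : x ^ (m + 1) - y ^ (m + 1) = (x ^ m - y ^ m) * x + y ^ m * (x - y) := by ring
    rw [this]
    refine norm_add_lt (norm_mul_lt_one_of_lt_of_le ih hx) (norm_mul_lt_one ?_ h)
    rw [norm_pow]
    exact pow_le_one₀ (norm_nonneg _) hy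

variable {F L : Type*} [NontriviallyNormedField F] [CompleteSpace F] [NormedField L]
  [NormedAlgebra F L] [FiniteDimensional F L]

lemma norm_algEquiv (σ : L ≃ₐ[F] L) (x : L) : ‖σ x‖ = ‖x‖ := norm_algHom (σ : L →ₐ[F] L) x

variable [IsUltrametricDist L]

lemma norm_two_le_one {E : Type*} [NormedDivisionRing E] [IsUltrametricDist E] :
    ‖(2 : E)‖ ≤ 1 := by
  rw [← one_add_one_eq_two]
  exact norm_add_le_of_le_of_le (by simp) (by simp)

/-- The nontrivial automorphism of an unramified quadratic extension moves the residue of some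
unit. -/
lemma exists_norm_sub_eq_one [ProperSpace L] (hunr : IsUnramified L F) {σ : L ≃ₐ[F] L}
    (hσ : ∃ x, σ x ≠ x) (hinv : ∀ x, σ (σ x) = x)
    (hfix : ∀ x, σ x = x → ∃ f, algebraMap F L f = x) :
    ∃ l : L, ‖l‖ = 1 ∧ ‖l - σ l‖ = 1 := by
  obtain ⟨x, hx⟩ := hσ
  -- Subtracting a closest point of `F` and rescaling by some `g ∈ F` of the same norm gives `y` of
  -- norm one at distance at least one from `F`: its residue is new.
  obtain ⟨f₀, hf₀⟩ := exists_closest (F := F) x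
  obtain ⟨g, hg⟩ := hunr (x - algebraMap F L f₀)
  have hg0 : g ≠ 0 := by
    rintro rfl
    rw [norm_zero, norm_eq_zero, sub_eq_zero] at hg
    rw [hg] at hx
    exact hx (σ.commutes f₀)
  have hgL : algebraMap F L g ≠ 0 := by simpa using hg0
  have hgn : ‖algebraMap F L g‖ = ‖x - algebraMap F L f₀‖ := by rw [hg, norm_algebraMap']
  have hgp : 0 < ‖algebraMap F L g‖ := norm_pos_iff.2 hgL
  obtain ⟨y, hy⟩ : ∃ y, y = (x - algebraMap F L f₀) / algebraMap F L g := ⟨_, rfl⟩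
  have hy1 : ‖y‖ = 1 := by rw [hy, norm_div, hgn, div_self (hgn ▸ hgp.ne')]
  have hyf : ∀ f : F, 1 ≤ ‖y - algebraMap F L f‖ := by
    intro f
    have h1 : y - algebraMap F L f =
        (x - algebraMap F L (f₀ + f * g)) / algebraMap F L g := by
      rw [hy, map_add, map_mul]
      field_simp
      ring
    rw [h1, norm_div, one_le_div hgp, hgn]
    exact hf₀ _
  have hσy : ‖σ y‖ = 1 := by rw [norm_algEquiv, hy1]
  refine ⟨y, hy1, le_antisymm (norm_sub_le_of_le hy1.le hσy.le) ?_⟩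
  by_contra! hlt
  obtain ⟨t, ht⟩ := hfix (y + σ y) (by rw [map_add, hinv, add_comm])
  obtain ⟨n, hn⟩ := hfix (y * σ y) (by rw [map_mul, hinv, mul_comm])
  -- If y ≡ σ(y), then y is congruent to an element of `F`. In residue characteristic 2, y² ≡ −yσ(y)
  -- = −n, and y ≡ y^q = (y²)^(q/2) for the even residue cardinality q. Otherwise y ≡ t/2.
  rcases (norm_two_le_one (E := L)).lt_or_eq with h2 | h2
  · obtain ⟨m, hm⟩ := even_card_residueRing h2
    have hyQ := norm_pow_card_sub_lt_one hy1.le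
    have hsq : ‖y ^ 2 - algebraMap F L (-n)‖ < 1 := by
      have : y ^ 2 - algebraMap F L (-n) = y * (2 * y - (y - σ y)) := by
        rw [map_neg, hn]; ring
      rw [this]
      exact norm_mul_lt_one hy1.le (norm_sub_lt (norm_mul_lt_one_of_lt_of_le h2 hy1.le) hlt)
    have hn1 : ‖algebraMap F L (-n)‖ ≤ 1 := by
      rw [map_neg, norm_neg, hn]
      exact norm_mul_le_one hy1.le hσy.le
    have hp := norm_pow_sub_pow_lt_one (by rw [norm_pow, hy1, one_pow]) hn1 hsq m
    refine (hyf ((-n) ^ m)).not_gt ?_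
    have : y - algebraMap F L ((-n) ^ m) = ((y ^ 2) ^ m - algebraMap F L (-n) ^ m) -
        (y ^ Nat.card (ResidueRing L) - y) := by
      rw [hm, map_pow]; ring
    rw [this]
    exact norm_sub_lt hp hyQ
  · have h20 : (2 : L) ≠ 0 := by
      rintro h
      simp [h] at h2
    refine (hyf (t / 2)).not_gt ?_
    have : y - algebraMap F L (t / 2) = (y - σ y) / 2 := by
      rw [map_div₀, ht, map_ofNat]
      field_simp
      ring
    rw [this, norm_div, h2, div_one]
    exact hlt

end Quadratic

/-! ### Quadratic elements of division algebras -/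

section Division

open Polynomial in
/-- Over a finite field, a finite extension field containing a quadratic element contains a root
of every quadratic polynomial. -/
lemma exists_root_of_quadratic_mem {k K : Type*} [Field k] [Field K] [Finite K] [Algebra k K]
    {y : K} (hy : y ∉ Set.range (algebraMap k K)) {t' n' : k}
    (hyq : y * y - algebraMap k K t' * y + algebraMap k K n' = 0) (t n : k) :
    ∃ z : K, z * z - algebraMap k K t * z + algebraMap k K n = 0 := by
  have hfk : Finite k := Finite.of_injective _ (algebraMap k K).injective
  have hquad : ∀ a b : k, (X ^ 2 - C a * X + C b : k[X]).natDegree = 2 := fun a b => by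
    compute_degree!
  have hmonic : ∀ a b : k, (X ^ 2 - C a * X + C b : k[X]) ≠ 0 := fun a b h => by
    have := hquad a b
    simp [h] at this
  have hint : IsIntegral k y := Algebra.IsIntegral.isIntegral y
  have hfin : Module.finrank k (IntermediateField.adjoin k {y}) = 2 := by
    rw [IntermediateField.adjoin.finrank hint]
    refine le_antisymm ?_ ((minpoly.two_le_natDegree_iff hint).2 fun ⟨a, ha⟩ => hy ⟨a, ha⟩)
    rw [← hquad t' n']
    refine natDegree_le_of_dvd (minpoly.dvd k y ?_) (hmonic _ _)
    simpa [sq] using hyq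
  -- An irreducible factor has degree dividing 2 = [k(y) : k], so the field it defines embeds in
  -- k(y).
  obtain ⟨p, hp, hpg⟩ := exists_irreducible_of_natDegree_pos
    (f := (X ^ 2 - C t * X + C n : k[X])) (by rw [hquad]; norm_num)
  have hp2 : p.natDegree ∣ 2 := by
    have h1 := hp.natDegree_pos
    have h2 := natDegree_le_of_dvd hpg (hmonic t n)
    rw [hquad] at h2
    interval_cases p.natDegree <;> norm_num
  have : Fact (Irreducible p) := ⟨hp⟩
  have hpfin : Module.finrank k (AdjoinRoot p) = p.natDegree := by
    rw [(AdjoinRoot.powerBasis hp.ne_zero).finrank, AdjoinRoot.powerBasis_dim]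
  obtain ⟨f⟩ := FiniteField.nonempty_algHom_of_finrank_dvd (F := k) (K := AdjoinRoot p)
    (L := IntermediateField.adjoin k {y}) (by rw [hpfin, hfin]; exact hp2)
  obtain ⟨q, hq⟩ := hpg
  have hroot : aeval (AdjoinRoot.root p) (X ^ 2 - C t * X + C n : k[X]) = 0 := by
    rw [hq, map_mul, AdjoinRoot.aeval_eq, AdjoinRoot.mk_self, zero_mul]
  obtain ⟨g, -⟩ : ∃ g : AdjoinRoot p →ₐ[k] K, True :=
    ⟨(IntermediateField.val _).comp f, trivial⟩
  refine ⟨g (AdjoinRoot.root p), ?_⟩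
  have h : aeval (g (AdjoinRoot.root p)) (X ^ 2 - C t * X + C n : k[X]) = 0 := by
    rw [aeval_algHom_apply, hroot, map_zero]
  simpa [sq] using h

variable {F D : Type*} [Field F] [DivisionRing D] [Algebra F D] [Algebra.IsCentral F D]

lemma mem_range_of_forall_commute {x : D} (h : ∀ y, y * x = x * y) :
    ∃ f, algebraMap F D f = x := by
  have : x ∈ Subalgebra.center F D := Subalgebra.mem_center_iff.2 h
  exact Algebra.mem_bot.1 (Algebra.IsCentral.out this)

/-- The Skolem–Noether theorem for roots of a quadratic polynomial. -/
lemma exists_conj_of_quadratic {a b : D} {t n : F} (ha : a ∉ Set.range (algebraMap F D))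
    (hqa : a * a - algebraMap F D t * a + algebraMap F D n = 0)
    (hqb : b * b - algebraMap F D t * b + algebraMap F D n = 0) :
    ∃ d : D, d ≠ 0 ∧ b * d = d * a := by
  -- Put ā = t − a, so that āa = n. Each by − yā intertwines `a` and `b`, so one nonzero value is
  -- enough. If all vanish, y = 1 gives b = ā, and then `a` is central.
  by_cases h : ∃ y, b * y - y * (algebraMap F D t - a) ≠ 0
  · obtain ⟨y, hy⟩ := h
    refine ⟨_, hy, ?_⟩
    have hty : ∀ x, algebraMap F D t * x = x * algebraMap F D t := Algebra.commutes t
    have hny : ∀ x, algebraMap F D n * x = x * algebraMap F D n := Algebra.commutes n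
    have hb : b * b = algebraMap F D t * b - algebraMap F D n := by
      rw [← sub_eq_zero, ← hqb]; abel
    have ha : a * a = algebraMap F D t * a - algebraMap F D n := by
      rw [← sub_eq_zero, ← hqa]; abel
    have h1 : b * (b * y - y * (algebraMap F D t - a)) =
        b * b * y - (b * y) * algebraMap F D t + b * y * a := by noncomm_ring
    have h2 : (b * y - y * (algebraMap F D t - a)) * a =
        b * y * a - y * (algebraMap F D t * a) + y * (a * a) := by noncomm_ring
    rw [h1, h2, hb, ha, sub_mul, mul_sub, mul_assoc, hty (b * y), hny y]
    abel
  · exfalso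
    push Not at h
    have h1 : b = algebraMap F D t - a := by simpa [sub_eq_zero] using h 1
    refine ha (mem_range_of_forall_commute fun y => ?_)
    have h2 := h y
    rw [h1, sub_mul, mul_sub, Algebra.commutes, sub_sub_sub_cancel_left, sub_eq_zero] at h2
    exact h2

/-- If `d` does not commute with `y`, the centralizer C of `y` meets Cd trivially. Hence dim C ≤ 2,
so 1 and y span C, and y² lies in C. -/
lemma mul_self_of_finrank_eq_four (hD : Module.finrank F D = 4) {y : D}
    (hy : y ∉ Set.range (algebraMap F D)) :
    ∃ t n : F, y * y - algebraMap F D t * y + algebraMap F D n = 0 := by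
  have hfd : FiniteDimensional F D := Module.finite_of_finrank_pos (by omega)
  obtain ⟨d, hd⟩ : ∃ d, d * y ≠ y * d := by
    by_contra! h
    exact hy (mem_range_of_forall_commute h)
  set C : Submodule F D := (Subalgebra.centralizer F {y}).toSubmodule with hC
  have hmem : ∀ x, x ∈ C ↔ x * y = y * x := fun x => by
    rw [hC, Subalgebra.mem_toSubmodule, Subalgebra.mem_centralizer_iff]
    simp [eq_comm]
  have hinj : Function.Injective (LinearMap.mulRight F d) := by
    refine mul_left_injective₀ ?_
    rintro rfl
    simp at hd
  have hdis : C ⊓ C.map (LinearMap.mulRight F d) = ⊥ := by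
    rw [eq_bot_iff]
    rintro x ⟨hx, c, hc, rfl⟩
    simp only [LinearMap.mulRight_apply, SetLike.mem_coe, Submodule.mem_bot] at hx hc ⊢
    rw [hmem] at hx hc
    by_contra h0
    have hc0 : c ≠ 0 := by rintro rfl; simp at h0
    apply hd
    apply mul_left_cancel₀ hc0
    rw [← mul_assoc, hx, ← mul_assoc, ← mul_assoc, hc]
  have hdim := Submodule.finrank_sup_add_finrank_inf_eq C (C.map (LinearMap.mulRight F d))
  have hle := Submodule.finrank_le (C ⊔ C.map (LinearMap.mulRight F d))
  rw [hdis, finrank_bot, ← (Submodule.equivMapOfInjective _ hinj C).finrank_eq] at hdim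
  have hli : LinearIndependent F ![(1 : D), y] := by
    rw [LinearIndependent.pair_iff' one_ne_zero]
    intro a ha
    exact hy ⟨a, by rw [Algebra.algebraMap_eq_smul_one, ha]⟩
  have hspan : Submodule.span F (Set.range ![(1 : D), y]) = C := by
    refine Submodule.eq_of_le_of_finrank_le ?_ ?_
    · rw [Submodule.span_le]
      rintro _ ⟨i, rfl⟩
      fin_cases i <;> simp [hmem]
    · rw [finrank_span_eq_card hli, Fintype.card_fin]
      omega
  have hyy : y * y ∈ C := by rw [hmem, mul_assoc]
  rw [← hspan, Matrix.range_cons, Matrix.range_cons, Matrix.range_empty, Set.union_empty,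
    Set.singleton_union, Submodule.mem_span_pair] at hyy
  obtain ⟨a, b, hab⟩ := hyy
  refine ⟨b, -a, ?_⟩
  rw [← hab, Algebra.smul_def, Algebra.smul_def, map_neg, mul_one]
  abel

end Division

/-! ### The residue field of D -/

section Embedding

variable {F D : Type*} [NontriviallyNormedField F]
  [NormedDivisionRing D] [IsUltrametricDist D] [NormedAlgebra F D] [Algebra.IsCentral F D]

lemma exists_norm_le_one_of_field (F : Type*) [NontriviallyNormedField F] {D : Type*}
    [NormedDivisionRing D] [NormedAlgebra F D] (x : D) :
    ∃ f : F, f ≠ 0 ∧ ‖algebraMap F D f * x‖ ≤ 1 := by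
  obtain ⟨f, hf0, hf⟩ := NormedField.exists_norm_lt F (r := (‖x‖ + 1)⁻¹) (by positivity)
  refine ⟨f, norm_pos_iff.1 hf0, ?_⟩
  rw [norm_mul, norm_algebraMap']
  have hx : 0 < ‖x‖ + 1 := by positivity
  calc ‖f‖ * ‖x‖ ≤ (‖x‖ + 1)⁻¹ * (‖x‖ + 1) := by gcongr; linarith
    _ = 1 := inv_mul_cancel₀ hx.ne'

/-- Elements of the valuation ring of `D` outside the center are roots of quadratic polynomials
with integral coefficients. -/
lemma exists_integral_quadratic (hD : Module.finrank F D = 4) {y : D}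
    (hy : y ∉ Set.range (algebraMap F D)) (hy1 : ‖y‖ ≤ 1) :
    ∃ t n : F, ‖t‖ ≤ 1 ∧ ‖n‖ ≤ 1 ∧
      y * y - algebraMap F D t * y + algebraMap F D n = 0 := by
  obtain ⟨t, n, h⟩ := mul_self_of_finrank_eq_four hD hy
  -- The other root t − y is conjugate to `y`, hence has the same norm; `t` and `n` are the sum and
  -- product of the two roots.
  have hconj : (algebraMap F D t - y) * (algebraMap F D t - y) -
      algebraMap F D t * (algebraMap F D t - y) + algebraMap F D n = 0 := by
    rw [← h, sub_mul, mul_sub y, ← Algebra.commutes t y]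
    abel
  obtain ⟨d, hd0, hd⟩ := exists_conj_of_quadratic hy h hconj
  have hn : ‖algebraMap F D t - y‖ = ‖y‖ := by
    have := congrArg norm hd
    rw [norm_mul, norm_mul, mul_comm ‖d‖] at this
    exact mul_right_cancel₀ (norm_ne_zero_iff.2 hd0) this
  refine ⟨t, n, ?_, ?_, h⟩
  · rw [← norm_algebraMap' D t]
    simpa using norm_add_le_of_le_of_le (hn.trans_le hy1) hy1
  · have : algebraMap F D n = (algebraMap F D t - y) * y := by
      rw [sub_mul, ← sub_eq_zero, ← h]; abel
    rw [← norm_algebraMap' D n, this]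
    exact norm_mul_le_one (hn.trans_le hy1) hy1

variable [CompleteSpace F]

/-- The residue ring of `D` is larger than that of its center `F`. -/
lemma exists_residually_new [ProperSpace D] (hD : Module.finrank F D = 4) :
    ∃ y : D, ‖y‖ ≤ 1 ∧ ∀ f : F, 1 ≤ ‖y - algebraMap F D f‖ := by
  have hfd : FiniteDimensional F D := Module.finite_of_finrank_pos (by omega)
  -- If `F` supplied all residues, expansion in powers of a uniformizer ϖ would make F[ϖ] dense
  -- among integral elements. Being finite-dimensional it is closed, so D = F[ϖ] would be
  -- commutative, hence equal to its center `F`.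
  by_contra! hno
  obtain ⟨ϖ, hϖ0, hϖ1, hmax⟩ := exists_uniformizer (E := D) (by
    obtain ⟨f, hf0, hf⟩ := NormedField.exists_norm_lt_one F
    exact ⟨algebraMap F D f, by simpa using norm_pos_iff.1 hf0, by rwa [norm_algebraMap']⟩)
  have happrox : ∀ (n : ℕ) (x : D), ‖x‖ ≤ 1 → ∃ z ∈ Algebra.adjoin F {ϖ}, ‖x - z‖ ≤ ‖ϖ‖ ^ n := by
    intro n
    induction n with
    | zero => exact fun x hx => ⟨0, Subalgebra.zero_mem _, by simpa using hx⟩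
    | succ n ih =>
      intro x hx
      obtain ⟨f, hf⟩ := hno x hx
      have hp : 0 < ‖ϖ‖ := norm_pos_iff.2 hϖ0
      obtain ⟨z, hz, hxz⟩ := ih ((x - algebraMap F D f) * ϖ⁻¹) (by
        rw [norm_mul, norm_inv, ← div_eq_mul_inv, div_le_one hp]
        exact hmax _ hf)
      refine ⟨algebraMap F D f + z * ϖ, add_mem (Subalgebra.algebraMap_mem _ _)
        (mul_mem hz (Algebra.self_mem_adjoin_singleton F ϖ)), ?_⟩
      have : x - (algebraMap F D f + z * ϖ) = ((x - algebraMap F D f) * ϖ⁻¹ - z) * ϖ := by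
        rw [sub_mul _ z, inv_mul_cancel_right₀ hϖ0]
        abel
      rw [this, norm_mul, pow_succ]
      gcongr
  have hcl : IsClosed ((Algebra.adjoin F {ϖ}).toSubmodule : Set D) :=
    Submodule.closed_of_finiteDimensional _
  have hint : ∀ x : D, ‖x‖ ≤ 1 → x ∈ Algebra.adjoin F {ϖ} := by
    intro x hx
    have : x ∈ closure ((Algebra.adjoin F {ϖ}).toSubmodule : Set D) := by
      rw [Metric.mem_closure_iff]
      intro ε hε
      obtain ⟨n, hn⟩ := exists_pow_lt_of_lt_one hε hϖ1
      obtain ⟨z, hz, hxz⟩ := happrox n x hx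
      exact ⟨z, hz, by rw [dist_eq_norm]; exact hxz.trans_lt hn⟩
    rwa [hcl.closure_eq] at this
  have htop : ∀ x : D, x ∈ Algebra.adjoin F {ϖ} := by
    intro x
    obtain ⟨f, hf0, hf⟩ := exists_norm_le_one_of_field F x
    have h := Subalgebra.smul_mem _ (hint _ hf) f⁻¹
    rwa [← Algebra.smul_def, smul_smul, inv_mul_cancel₀ hf0, one_smul] at h
  have hcent : Algebra.adjoin F {ϖ} ≤ Subalgebra.centralizer F {ϖ} := by
    rw [Algebra.adjoin_le_iff, Set.singleton_subset_iff]
    exact Set.mem_centralizer_iff.2 (by simp)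
  obtain ⟨f, hf⟩ := mem_range_of_forall_commute (F := F) (x := ϖ) fun y =>
    (Subalgebra.mem_centralizer_iff F |>.1 (hcent (htop y)) ϖ rfl).symm
  have hbot : (⊥ : Subalgebra F D) = ⊤ := by
    rw [eq_top_iff]
    intro x _
    have hle : Algebra.adjoin F {ϖ} ≤ ⊥ := by
      rw [Algebra.adjoin_le_iff, Set.singleton_subset_iff, ← hf]
      exact Subalgebra.algebraMap_mem _ _
    exact hle (htop x)
  have := Subalgebra.bot_eq_top_iff_finrank_eq_one.1 hbot
  omega

/-- The map of residue rings induced by `F → D`. -/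
noncomputable def residueMap (F D : Type*) [NormedField F] [IsUltrametricDist F]
    [NormedDivisionRing D] [IsUltrametricDist D] [NormedAlgebra F D] :
    ResidueRing F →+* ResidueRing D :=
  Ideal.quotientMap (residueIdeal D)
    ((algebraMap F D).restrict (valRing F) (valRing D)
      (fun x hx => mem_valRing.2 ((norm_algebraMap' D x).trans_le (mem_valRing.1 hx))))
    (fun x hx => (norm_algebraMap' D (x : F)).trans_lt hx)

/-- The residue of a residually new `y` is quadratic over the residue field of `F`, and a quadratic
extension of a finite field contains roots of all quadratics over it. -/
lemma exists_residual_root [IsUltrametricDist F] [ProperSpace F] [ProperSpace D]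
    (hD : Module.finrank F D = 4) {t n : F} (ht : ‖t‖ ≤ 1) (hn : ‖n‖ ≤ 1) :
    ∃ z : D, ‖z‖ ≤ 1 ∧ ‖z * z - algebraMap F D t * z + algebraMap F D n‖ < 1 := by
  obtain ⟨y, hy1, hy⟩ := exists_residually_new hD
  obtain ⟨t', n', ht', hn', hq⟩ := exists_integral_quadratic (F := F) hD (y := y) (by
    rintro ⟨f, rfl⟩
    have := hy f
    simp at this
    linarith) hy1
  let kF : Field (ResidueRing F) := isField_residueRing.toField
  let kD : Field (ResidueRing D) := isField_residueRing.toField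
  let φ : ResidueRing F →+* ResidueRing D := residueMap F D
  let alg : Algebra (ResidueRing F) (ResidueRing D) := φ.toAlgebra
  have hnew : Ideal.Quotient.mk (residueIdeal D) ⟨y, hy1⟩ ∉
      Set.range (algebraMap (ResidueRing F) (ResidueRing D)) := by
    rintro ⟨f, hf⟩
    obtain ⟨f, rfl⟩ := Ideal.Quotient.mk_surjective f
    exact (hy f).not_gt (residue_eq_zero_iff.1 (sub_eq_zero.2 hf.symm))
  obtain ⟨z, hz⟩ := exists_root_of_quadratic_mem hnew (t' := Ideal.Quotient.mk _ ⟨t', ht'⟩)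
    (n' := Ideal.Quotient.mk _ ⟨n', hn'⟩)
    (residue_eq_zero_iff.2 (by
      change ‖y * y - algebraMap F D t' * y + algebraMap F D n'‖ < 1
      rw [hq, norm_zero]
      exact one_pos))
    (Ideal.Quotient.mk _ ⟨t, ht⟩) (Ideal.Quotient.mk _ ⟨n, hn⟩)
  obtain ⟨z, rfl⟩ := Ideal.Quotient.mk_surjective z
  exact ⟨z, z.2, residue_eq_zero_iff.1 hz⟩

end Embedding

/-! ### Hensel's lemma and the embedding of L into D -/

section Embedding

variable {F D : Type*} [NontriviallyNormedField F] [NormedDivisionRing D]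
  [IsUltrametricDist D] [NormedAlgebra F D]

/-- Hensel's lemma for a quadratic polynomial with unit discriminant. -/
lemma exists_root_of_residual_root [ProperSpace D] {t n : F}
    (hdisc : ‖t * t - 4 * n‖ = 1)
    (h : ∃ z : D, ‖z‖ ≤ 1 ∧ ‖z * z - algebraMap F D t * z + algebraMap F D n‖ < 1) :
    ∃ z : D, z * z - algebraMap F D t * z + algebraMap F D n = 0 := by
  obtain ⟨T, hT⟩ : ∃ T, T = algebraMap F D t := ⟨_, rfl⟩
  obtain ⟨N, hN⟩ : ∃ N, N = algebraMap F D n := ⟨_, rfl⟩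
  have hTc : ∀ x, T * x = x * T := by rw [hT]; exact Algebra.commutes t
  have hNc : ∀ x, N * x = x * N := by rw [hN]; exact Algebra.commutes n
  rw [← hT, ← hN] at h ⊢
  obtain ⟨z₁, hz₁, hlt₁⟩ := h
  -- Compactness replaces Newton iteration. At a minimum with value g ≠ 0, the derivative u = 2z − t
  -- is a unit because u² = 4g + (t² − 4n). One Newton step h = g/u changes the value to h², of norm
  -- |g|² < |g|.
  obtain ⟨z, hz, hmin⟩ := (isCompact_closedBall (0 : D) 1).exists_isMinOn ⟨z₁, by simpa using hz₁⟩
    (f := fun z => ‖z * z - T * z + N‖) (by fun_prop)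
  have hlt : ‖z * z - T * z + N‖ < 1 := (hmin (by simpa using hz₁)).trans_lt hlt₁
  have hz1 : ‖z‖ ≤ 1 := by simpa using hz
  refine ⟨z, ?_⟩
  by_contra hne
  obtain ⟨g, hg⟩ : ∃ g, g = z * z - T * z + N := ⟨_, rfl⟩
  obtain ⟨u, hu⟩ : ∃ u, u = z + z - T := ⟨_, rfl⟩
  have hzT : Commute z T := (hTc z).symm
  have hzg : Commute z g := by
    rw [hg]
    exact (((Commute.refl z).mul_right (Commute.refl z)).sub_right
      (hzT.mul_right (Commute.refl z))).add_right (hNc z).symm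
  have hzu : Commute z u := by
    rw [hu]
    exact ((Commute.refl z).add_right (Commute.refl z)).sub_right hzT
  have hug : Commute u g := by
    rw [hu]
    exact (hzg.add_left hzg).sub_left (hTc g)
  have hu2 : u * u = (g + g + g + g) + algebraMap F D (t * t - 4 * n) := by
    have h4 : algebraMap F D (t * t - 4 * n) = T * T - (N + N + N + N) := by
      rw [hT, hN, map_sub, map_mul, map_mul, map_ofNat]
      noncomm_ring
    rw [h4, hu, hg]
    have h1 : (z + z - T) * (z + z - T) = z * z + z * z + z * z + z * z - z * T - z * T
      - T * z - T * z + T * T := by noncomm_ring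
    rw [h1, ← hTc z]
    abel
  have hg1 : ‖g‖ < 1 := hg ▸ hlt
  have hu1 : ‖u‖ = 1 := by
    have h2 : ‖u * u‖ = 1 := by
      have hd : ‖algebraMap F D (t * t - 4 * n)‖ = 1 := by rw [norm_algebraMap', hdisc]
      have : ‖algebraMap F D (t * t - 4 * n) - u * u‖ < ‖algebraMap F D (t * t - 4 * n)‖ := by
        rw [hd, hu2, sub_add_cancel_right, norm_neg]
        exact norm_add_lt (norm_add_lt (norm_add_lt hg1 hg1) hg1) hg1
      rw [norm_eq_of_norm_sub_lt this, hd]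
    rw [norm_mul, ← sq] at h2
    exact (pow_eq_one_iff_of_nonneg (norm_nonneg _) two_ne_zero).1 h2
  have hu0 : u ≠ 0 := by
    rintro h
    simp [h] at hu1
  obtain ⟨h, hh⟩ : ∃ h, h = g * u⁻¹ := ⟨_, rfl⟩
  have hhn : ‖h‖ = ‖g‖ := by rw [hh, norm_mul, norm_inv, hu1, inv_one, mul_one]
  have hzh : Commute z h := by
    rw [hh]
    exact hzg.mul_right hzu.inv_right₀
  have huh : h * u = g := by rw [hh, inv_mul_cancel_right₀ hu0]
  have hstep : (z - h) * (z - h) - T * (z - h) + N = h * h := by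
    have h1 : (z - h) * (z - h) - T * (z - h) + N =
        (z * z - T * z + N) - (h * z + z * h - T * h) + h * h := by noncomm_ring
    have h2 : h * z + z * h - T * h = h * u := by
      rw [hu, hzh.eq, hTc h]; noncomm_ring
    rw [h1, h2, huh, hg, sub_self, zero_add]
  have hle := hmin (a := z - h) (by
    simpa using norm_sub_le_of_le hz1 (hhn.trans_le hg1.le))
  have hle' : ‖g‖ ≤ ‖g‖ * ‖g‖ := by
    have : ‖z * z - T * z + N‖ ≤ ‖(z - h) * (z - h) - T * (z - h) + N‖ := hle
    rwa [hstep, ← hg, norm_mul, hhn] at this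
  have hg0 : 0 < ‖g‖ := norm_pos_iff.2 (hg ▸ hne)
  nlinarith

/-- An unramified quadratic extension of `F` embeds into the quaternion division algebra. -/
lemma nonempty_algHom [CompleteSpace F] [Algebra.IsCentral F D] {L : Type*} [NormedField L]
    [IsUltrametricDist L] [NormedAlgebra F L] [FiniteDimensional F L] [IsUltrametricDist F]
    [ProperSpace F] [ProperSpace D]
    (hL : Module.finrank F L = 2) (hD : Module.finrank F D = 4) {σ : L ≃ₐ[F] L} {l : L}
    (hl : ‖l‖ = 1) (hlσ : ‖l - σ l‖ = 1) (hinv : ∀ x, σ (σ x) = x)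
    (hfix : ∀ x, σ x = x → ∃ f, algebraMap F L f = x) : Nonempty (L →ₐ[F] D) := by
  obtain ⟨t, ht⟩ := hfix (l + σ l) (by rw [map_add, hinv, add_comm])
  obtain ⟨n, hn⟩ := hfix (l * σ l) (by rw [map_mul, hinv, mul_comm])
  have hσl : ‖σ l‖ = 1 := by rw [norm_algEquiv, hl]
  have ht1 : ‖t‖ ≤ 1 := by
    rw [← norm_algebraMap' L t, ht]
    exact norm_add_le_of_le_of_le hl.le hσl.le
  have hn1 : ‖n‖ ≤ 1 := by
    rw [← norm_algebraMap' L n, hn]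
    exact norm_mul_le_one hl.le hσl.le
  have hdisc : ‖t * t - 4 * n‖ = 1 := by
    have : algebraMap F L (t * t - 4 * n) = (l - σ l) * (l - σ l) := by
      rw [map_sub, map_mul, map_mul, map_ofNat, ht, hn]; ring
    rw [← norm_algebraMap' L, this, norm_mul, hlσ, one_mul]
  obtain ⟨z, hz⟩ := exists_root_of_residual_root hdisc (exists_residual_root hD ht1 hn1)
  have hint : IsIntegral F l := Algebra.IsIntegral.isIntegral l
  have hnot : l ∉ (algebraMap F L).range := by
    rintro ⟨f, hf⟩
    rw [← hf, AlgEquiv.commutes, sub_self, norm_zero] at hlσ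
    exact zero_ne_one hlσ
  have hq : Polynomial.aeval l (.X ^ 2 - .C t * .X + .C n : Polynomial F) = 0 := by
    simp only [map_add, map_sub, map_mul, map_pow, Polynomial.aeval_X, Polynomial.aeval_C, ht, hn]
    ring
  have hmonic : (.X ^ 2 - .C t * .X + .C n : Polynomial F).Monic := by monicity!
  have hdeg : (.X ^ 2 - .C t * .X + .C n : Polynomial F).natDegree = 2 := by compute_degree!
  have h2 := (minpoly.two_le_natDegree_iff hint).2 hnot
  have hmin : minpoly F l = .X ^ 2 - .C t * .X + .C n :=
    (Polynomial.eq_of_monic_of_dvd_of_natDegree_le (minpoly.monic hint) hmonic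
      (minpoly.dvd F l hq) (by rw [hdeg]; exact h2)).symm
  have htop : Algebra.adjoin F {l} = ⊤ := by
    rw [← IntermediateField.adjoin_eq_top_iff,
      Field.primitive_element_iff_minpoly_natDegree_eq, hmin, hdeg, hL]
  refine ⟨(PowerBasis.ofAdjoinEqTop hint htop).lift z ?_⟩
  rw [PowerBasis.ofAdjoinEqTop_gen, hmin]
  simpa [sq] using hz

end Embedding

/-! ### The decomposition D = L ⊕ Lϖ -/

section Frame

lemma exists_add_mul_of_finrank_eq_two {F L : Type*} [Field F] [Field L] [Algebra F L]
    [FiniteDimensional F L]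
    (hL : Module.finrank F L = 2) {l : L} (hl : l ∉ Set.range (algebraMap F L)) (x : L) :
    ∃ p q : F, x = algebraMap F L p + algebraMap F L q * l := by
  have hli : LinearIndependent F ![(1 : L), l] := by
    rw [LinearIndependent.pair_iff' one_ne_zero]
    intro a ha
    exact hl ⟨a, by rw [Algebra.algebraMap_eq_smul_one, ha]⟩
  have hspan := hli.span_eq_top_of_card_eq_finrank' (by rw [Fintype.card_fin, hL])
  have hx : x ∈ Submodule.span F (Set.range ![(1 : L), l]) := hspan ▸ Submodule.mem_top
  rw [Matrix.range_cons, Matrix.range_cons, Matrix.range_empty, Set.union_empty,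
    Set.singleton_union, Submodule.mem_span_pair] at hx
  obtain ⟨p, q, h⟩ := hx
  exact ⟨p, q, by rw [← h, Algebra.smul_def, Algebra.smul_def, mul_one]⟩

/-- The Skolem–Noether theorem for quadratic subfields. -/
lemma exists_conj_algHom {F L D : Type*} [Field F] [Field L] [Algebra F L] [FiniteDimensional F L]
    [DivisionRing D] [Algebra F D] [Algebra.IsCentral F D] (hL : Module.finrank F L = 2)
    (ι ι' : L →ₐ[F] D) : ∃ d : D, d ≠ 0 ∧ ∀ x, ι' x * d = d * ι x := by
  obtain ⟨l, hl⟩ : ∃ l : L, l ∉ Set.range (algebraMap F L) := by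
    by_contra! h
    have : (⊥ : Subalgebra F L) = ⊤ := by
      rw [eq_top_iff]
      exact fun x _ => Algebra.mem_bot.2 (h x)
    rw [Subalgebra.bot_eq_top_iff_finrank_eq_one, hL] at this
    omega
  obtain ⟨n, t, ht⟩ := exists_add_mul_of_finrank_eq_two hL hl (l * l)
  have hq : l * l - algebraMap F L t * l + algebraMap F L (-n) = 0 := by
    rw [ht, map_neg]; ring
  have hφ : ∀ φ : L →ₐ[F] D,
      φ l * φ l - algebraMap F D t * φ l + algebraMap F D (-n) = 0 := fun φ => by
    simpa only [map_add, map_sub, map_mul, AlgHom.commutes, map_zero] using congrArg φ hq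
  obtain ⟨d, hd0, hd⟩ := exists_conj_of_quadratic (a := ι l) (b := ι' l) (by
    rintro ⟨f, hf⟩
    exact hl ⟨f, ι.injective ((ι.commutes f).trans hf)⟩) (hφ ι) (hφ ι')
  refine ⟨d, hd0, fun x => ?_⟩
  obtain ⟨p, q, rfl⟩ := exists_add_mul_of_finrank_eq_two hL hl x
  simp only [map_add, map_mul, AlgHom.commutes]
  rw [add_mul, mul_add, mul_assoc, hd, ← Algebra.commutes p d, ← mul_assoc, ← mul_assoc,
    Algebra.commutes q d]

variable {F L D : Type*} [NontriviallyNormedField F] [NormedField L] [NormedAlgebra F L]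
  [NormedDivisionRing D] [NormedAlgebra F D]

/-- A presentation `D = L ⊕ L ϖ` of a quaternion algebra, with `ϖ² = c` a uniformizer of `F` and
`ϖ x = σ(x) ϖ` for `x ∈ L`. -/
structure Frame (ι : L →ₐ[F] D) where
  σ : L ≃ₐ[F] L
  invol : ∀ x, σ (σ x) = x
  fixed : ∀ x, σ x = x → ∃ f, algebraMap F L f = x
  unr : IsUnramified L F
  l : L
  norm_l : ‖l‖ = 1
  norm_l_sub : ‖l - σ l‖ = 1
  ϖ : D
  c : F
  ϖ_mul : ∀ x, ϖ * ι x = ι (σ x) * ϖ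
  ϖ_sq : ϖ * ϖ = algebraMap F D c
  c_ne : c ≠ 0
  norm_c : ‖c‖ < 1
  le_c : ∀ f : F, ‖f‖ < 1 → ‖f‖ ≤ ‖c‖
  fst : D →ₗ[F] L
  snd : D →ₗ[F] L
  eq_add : ∀ x, x = ι (fst x) + ι (snd x) * ϖ
  fst_add : ∀ a b, fst (ι a + ι b * ϖ) = a
  snd_add : ∀ a b, snd (ι a + ι b * ϖ) = b

variable [CompleteSpace F] [FiniteDimensional F L] [Algebra.IsCentral F D]

/-- Skolem–Noether gives `d` inducing σ on L. Its norm is not a value of `F`, hence not one of L, so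
L + Ld is direct and fills D by dimension. Then d² commutes with L and `d`, so it lies in `F`; its
valuation is odd, and scaling `d` by `F` makes the square a uniformizer. -/
lemma nonempty_frame [IsUltrametricDist F] [ProperSpace F] [IsUltrametricDist L]
    [IsUltrametricDist D] [ProperSpace D]
    (hunr : IsUnramified L F) (hL : Module.finrank F L = 2) (hD : Module.finrank F D = 4)
    {σ : L ≃ₐ[F] L} {l : L} (hl : ‖l‖ = 1) (hlσ : ‖l - σ l‖ = 1) (hinv : ∀ x, σ (σ x) = x)
    (hfix : ∀ x, σ x = x → ∃ f, algebraMap F L f = x) (ι : L →ₐ[F] D) :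
    ∃ fr : Frame ι, fr.σ = σ := by
  have hfd : FiniteDimensional F D := Module.finite_of_finrank_pos (by omega)
  obtain ⟨d, hd0, hd⟩ := exists_conj_algHom hL ι (ι.comp (σ : L →ₐ[F] L))
  replace hd : ∀ x, d * ι x = ι (σ x) * d := fun x => (hd x).symm
  -- Otherwise `d` could be scaled to norm one, and its additive commutator with `ι l` would have
  -- norm |l − σ(l)| = 1, against commutativity of the residue ring.
  have hdn : ∀ f : F, ‖d‖ ≠ ‖f‖ := by
    intro f hf
    have hf0 : f ≠ 0 := by
      rintro rfl
      rw [norm_zero, norm_eq_zero] at hf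
      exact hd0 hf
    have hfD : algebraMap F D f ≠ 0 := by simpa using hf0
    have hfn : ‖algebraMap F D f‖ = ‖d‖ := by rw [norm_algebraMap', hf]
    have h1 : ‖(algebraMap F D f)⁻¹ * d‖ = 1 := by
      rw [norm_mul, norm_inv, hfn, inv_mul_cancel₀ (norm_ne_zero_iff.2 hd0)]
    have h2 := norm_commutator_lt_one h1.le (y := ι l) (by rw [norm_algHom, hl])
    have h3 : (algebraMap F D f)⁻¹ * d * ι l - ι l * ((algebraMap F D f)⁻¹ * d) =
        - (ι (l - σ l) * ((algebraMap F D f)⁻¹ * d)) := by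
      have hc : ∀ x, (algebraMap F D f)⁻¹ * x = x * (algebraMap F D f)⁻¹ := fun x =>
        ((show Commute (algebraMap F D f) x from Algebra.commutes f x).inv_left₀).eq
      rw [mul_assoc, hd, ← mul_assoc, hc (ι (σ l)), map_sub, sub_mul, neg_sub, mul_assoc]
    rw [h3, norm_neg, norm_mul, h1, norm_algHom, hlσ, mul_one] at h2
    exact lt_irrefl _ h2
  have hspan : ∀ e : D, (∀ f : F, ‖e‖ ≠ ‖f‖) → Function.Bijective
      ((ι.toLinearMap ∘ₗ LinearMap.fst F L L) +
        (LinearMap.mulRight F e ∘ₗ ι.toLinearMap ∘ₗ LinearMap.snd F L L)) := by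
    intro e he
    set m := ((ι.toLinearMap ∘ₗ LinearMap.fst F L L) +
        (LinearMap.mulRight F e ∘ₗ ι.toLinearMap ∘ₗ LinearMap.snd F L L)) with hm
    have hinj : Function.Injective m := by
      rw [← LinearMap.ker_eq_bot, LinearMap.ker_eq_bot']
      rintro ⟨a, b⟩ hab
      replace hab : ι a + ι b * e = 0 := hab
      by_cases hb : b = 0
      · subst hb
        rw [map_zero, zero_mul, add_zero, map_eq_zero] at hab
        rw [hab]; rfl
      · exfalso
        have h1 := congrArg norm (eq_neg_of_add_eq_zero_left hab)
        rw [norm_neg, norm_mul, norm_algHom, norm_algHom] at h1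
        obtain ⟨f, hf⟩ := hunr (a / b)
        refine he f ?_
        rw [← hf, norm_div, h1, mul_div_cancel_left₀ _ (norm_ne_zero_iff.2 hb)]
    refine ⟨hinj, (LinearMap.injective_iff_surjective_of_finrank_eq_finrank ?_).1 hinj⟩
    rw [Module.finrank_prod, hL, hD]
  obtain ⟨c', hc'⟩ := mem_range_of_forall_commute (F := F) (x := d * d) fun y => by
    obtain ⟨⟨a, b⟩, rfl⟩ := (hspan d hdn).2 y
    change (ι a + ι b * d) * (d * d) = d * d * (ι a + ι b * d)
    have h1 : ∀ x, d * d * ι x = ι x * (d * d) := fun x => by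
      rw [mul_assoc, hd, ← mul_assoc, hd, hinv, mul_assoc]
    rw [mul_add, h1, ← mul_assoc (d * d) (ι b) d, h1]
    noncomm_ring
  obtain ⟨π, hπ0, hπ1, hmax⟩ := exists_uniformizer (E := F) (by
    obtain ⟨f, hf0, hf⟩ := NormedField.exists_norm_lt_one F
    exact ⟨f, norm_pos_iff.1 hf0, hf⟩)
  have hπp : 0 < ‖π‖ := norm_pos_iff.2 hπ0
  have hc'n : ‖c'‖ = ‖d‖ ^ 2 := by rw [← norm_algebraMap' D c', hc', norm_mul, sq]
  have hc'p : 0 < ‖c'‖ := by rw [hc'n]; exact pow_pos (norm_pos_iff.2 hd0) 2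
  obtain ⟨m, hm⟩ : ∃ m : ℤ, ‖c'‖ = ‖π‖ ^ m := by
    -- Bracket ‖c'‖ between consecutive powers of ‖π‖⁻¹ > 1; maximality of ‖π‖ below one excludes
    -- values strictly in between.
    obtain ⟨k, hk1, hk2⟩ := exists_mem_Ico_zpow hc'p ((one_lt_inv₀ hπp).2 hπ1)
    rw [inv_zpow'] at hk1 hk2
    rw [neg_add, ← sub_eq_add_neg, zpow_sub_one₀ hπp.ne'] at hk2
    refine ⟨-k, le_antisymm ?_ hk1⟩
    by_contra! hlt
    have h1 := hmax (π ^ (-k) / c') (by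
      rw [norm_div, norm_zpow, div_lt_one hc'p]; exact hlt)
    rw [norm_div, norm_zpow, div_le_iff₀ hc'p] at h1
    have h2 : ‖c'‖ * ‖π‖ < ‖π‖ ^ (-k) := by
      calc ‖c'‖ * ‖π‖ < ‖π‖ ^ (-k) * ‖π‖⁻¹ * ‖π‖ := by gcongr
        _ = _ := inv_mul_cancel_right₀ hπp.ne' _
    linarith [mul_comm ‖c'‖ ‖π‖]
  -- An even exponent would make ‖d‖ a value of `F`. For the exponent 2k + 1, scaling `d` by π^(−k)
  -- leaves exponent 1.
  obtain ⟨k, hk⟩ : Odd m := by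
    rw [← Int.not_even_iff_odd]
    rintro ⟨k, rfl⟩
    refine hdn (π ^ k) ?_
    rw [hc'n, zpow_add₀ hπp.ne', ← sq] at hm
    rw [norm_zpow]
    exact (pow_left_inj₀ (norm_nonneg _) (zpow_nonneg hπp.le _) two_ne_zero).1 hm
  obtain ⟨g, hg⟩ : ∃ g : F, g = π ^ (-k) := ⟨_, rfl⟩
  have hg0 : g ≠ 0 := hg ▸ zpow_ne_zero _ hπ0
  have hcn : ‖g * g * c'‖ = ‖π‖ := by
    rw [norm_mul, norm_mul, hm, hk, hg, norm_zpow, ← zpow_add₀ hπp.ne', ← zpow_add₀ hπp.ne']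
    have : -k + -k + (2 * k + 1) = 1 := by ring
    rw [this, zpow_one]
  have hb := hspan (algebraMap F D g * d) fun f hf => by
    refine hdn (f / g) ?_
    rw [norm_mul, norm_algebraMap'] at hf
    rw [norm_div, ← hf, mul_div_cancel_left₀ _ (norm_ne_zero_iff.2 hg0)]
  set e := LinearEquiv.ofBijective _ hb with he
  have hea : ∀ p : L × L, e p = ι p.1 + ι p.2 * (algebraMap F D g * d) := fun p => rfl
  refine ⟨{
    σ := σ
    invol := hinv
    fixed := hfix
    unr := hunr
    l := l
    norm_l := hl
    norm_l_sub := hlσ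
    ϖ := algebraMap F D g * d
    c := g * g * c'
    ϖ_mul := fun x => by rw [mul_assoc, hd, ← mul_assoc, Algebra.commutes, mul_assoc]
    ϖ_sq := by
      rw [map_mul, map_mul, hc', ← mul_assoc, mul_assoc _ d, ← Algebra.commutes g d]
      noncomm_ring
    c_ne := by
      rw [← norm_ne_zero_iff, hcn]
      exact hπp.ne'
    norm_c := hcn ▸ hπ1
    le_c := fun f hf => hcn ▸ hmax f hf
    fst := LinearMap.fst F L L ∘ₗ e.symm.toLinearMap
    snd := LinearMap.snd F L L ∘ₗ e.symm.toLinearMap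
    eq_add := fun x => (hea (e.symm x) ▸ e.apply_symm_apply x).symm
    fst_add := fun a b => by
      change (e.symm (e (a, b))).1 = a
      rw [e.symm_apply_apply]
    snd_add := fun a b => by
      change (e.symm (e (a, b))).2 = b
      rw [e.symm_apply_apply] }, rfl⟩

end Frame

/-! ### Commutators of units -/

section Commutators

variable {E : Type*} [NormedDivisionRing E] [IsUltrametricDist E]

lemma norm_coe_units (u : (valRing E)ˣ) : ‖((u : valRing E) : E)‖ = 1 := by
  refine le_antisymm (u : valRing E).2 ?_
  have h1 : ‖((u⁻¹ : (valRing E)ˣ) : valRing E).1‖ ≤ 1 := ((u⁻¹ : (valRing E)ˣ) : valRing E).2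
  have h2 : ‖((u : valRing E) : E)‖ * ‖((u⁻¹ : (valRing E)ˣ) : valRing E).1‖ = 1 := by
    rw [← norm_mul, ← Subring.coe_mul, Units.mul_inv]
    simp
  nlinarith [norm_nonneg ((u : valRing E) : E)]

omit [IsUltrametricDist E] in
lemma ne_zero_of_norm_eq_one {x : E} (hx : ‖x‖ = 1) : x ≠ 0 := by
  rintro rfl
  simp at hx

/-- An element of norm one, as a unit of the valuation ring. -/
def unitOfNorm (x : E) (hx : ‖x‖ = 1) : (valRing E)ˣ where
  val := ⟨x, hx.le⟩
  inv := ⟨x⁻¹, by rw [mem_valRing, norm_inv, hx, inv_one]⟩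
  val_inv := Subtype.ext (mul_inv_cancel₀ (ne_zero_of_norm_eq_one hx))
  inv_val := Subtype.ext (inv_mul_cancel₀ (ne_zero_of_norm_eq_one hx))

/-- `x` lies in the commutator subgroup of the unit group of the valuation ring. -/
def InComm (x : E) : Prop := ∃ u ∈ commutator (valRing E)ˣ, ((u : valRing E) : E) = x

lemma InComm.mul {x y : E} (hx : InComm x) (hy : InComm y) : InComm (x * y) := by
  obtain ⟨u, hu, rfl⟩ := hx
  obtain ⟨v, hv, rfl⟩ := hy
  exact ⟨u * v, mul_mem hu hv, rfl⟩

lemma InComm.inv {x : E} (hx : InComm x) : InComm x⁻¹ := by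
  obtain ⟨u, hu, rfl⟩ := hx
  refine ⟨u⁻¹, inv_mem hu, ?_⟩
  refine eq_inv_of_mul_eq_one_left ?_
  rw [← Subring.coe_mul, Units.inv_mul]
  rfl

lemma InComm.norm_eq {x : E} (hx : InComm x) : ‖x‖ = 1 := by
  obtain ⟨u, -, rfl⟩ := hx
  exact norm_coe_units u

/-- The relation ab = x(ba) says x = aba⁻¹b⁻¹ without inverses, so it can be checked in coordinates.
-/
lemma inComm_of_mul_eq {x a b : E} (ha : ‖a‖ = 1) (hb : ‖b‖ = 1) (h : a * b = x * (b * a)) :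
    InComm x := by
  refine ⟨⁅unitOfNorm a ha, unitOfNorm b hb⁆,
    Subgroup.commutator_mem_commutator (Subgroup.mem_top _) (Subgroup.mem_top _), ?_⟩
  have ha0 : a ≠ 0 := ne_zero_of_norm_eq_one ha
  have hb0 : b ≠ 0 := ne_zero_of_norm_eq_one hb
  change a * b * a⁻¹ * b⁻¹ = x
  rw [h, ← mul_assoc, mul_inv_cancel_right₀ ha0, mul_inv_cancel_right₀ hb0]

/-- The commutator subgroup consists of elements which are trivial in the residue ring and have
trivial image under every multiplicative map to a commutative monoid. -/
lemma InComm.map_eq_one {M : Type*} [CommMonoid M] (f : E →* M) {x : E} (hx : InComm x) :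
    f x = 1 := by
  obtain ⟨u, hu, rfl⟩ := hx
  let g : (valRing E)ˣ →* Mˣ := Units.map (f.comp ((valRing E).subtype : valRing E →* E))
  have : u ∈ g.ker := Abelianization.commutator_subset_ker g hu
  exact congrArg Units.val (MonoidHom.mem_ker.1 this)

lemma InComm.norm_sub_one_lt [ProperSpace E] {x : E} (hx : InComm x) : ‖x - 1‖ < 1 := by
  obtain ⟨u, hu, rfl⟩ := hx
  let M : CommMonoid (ResidueRing E) :=
    { (inferInstance : Monoid (ResidueRing E)) with
      mul_comm := isField_residueRing.mul_comm }
  let g : (valRing E)ˣ →* (ResidueRing E)ˣ :=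
    Units.map (Ideal.Quotient.mk (residueIdeal E) : valRing E →* ResidueRing E)
  have : u ∈ g.ker := Abelianization.commutator_subset_ker g hu
  have h : Ideal.Quotient.mk (residueIdeal E) u = 1 := congrArg Units.val (MonoidHom.mem_ker.1 this)
  have h' : Ideal.Quotient.mk (residueIdeal E) (u - 1) = 0 := by rw [map_sub, h, map_one, sub_self]
  exact residue_eq_zero_iff.1 h'

end Commutators

/-! ### Coordinates, reduced norm and absolute value -/

namespace Frame

variable {F L D : Type*} [NontriviallyNormedField F] [NormedField L] [NormedAlgebra F L]
  [NormedDivisionRing D] [NormedAlgebra F D] {ι : L →ₐ[F] D} (fr : Frame ι)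

/-- The element `ϖ²`, in `L`. -/
def C : L := algebraMap F L fr.c

lemma ι_C : ι fr.C = fr.ϖ * fr.ϖ := by rw [fr.ϖ_sq, C, AlgHom.commutes]

@[simp]
lemma σ_C : fr.σ fr.C = fr.C := fr.σ.commutes _

@[simp]
lemma σ_σ (x : L) : fr.σ (fr.σ x) = x := fr.invol x

lemma add_mul_add (a b a' b' : L) : (ι a + ι b * fr.ϖ) * (ι a' + ι b' * fr.ϖ) =
    ι (a * a' + fr.C * b * fr.σ b') + ι (a * b' + b * fr.σ a') * fr.ϖ := by
  have h1 : ι b * fr.ϖ * ι a' = ι (b * fr.σ a') * fr.ϖ := by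
    rw [mul_assoc, fr.ϖ_mul, map_mul, mul_assoc]
  have h2 : ι b * fr.ϖ * (ι b' * fr.ϖ) = ι (fr.C * b * fr.σ b') := by
    have : fr.C * b * fr.σ b' = b * fr.σ b' * fr.C := by ring
    rw [this, map_mul, map_mul, fr.ι_C, ← mul_assoc, mul_assoc (ι b), fr.ϖ_mul, ← mul_assoc,
      mul_assoc _ fr.ϖ fr.ϖ]
  rw [mul_add, add_mul, add_mul, h1, h2, map_add, map_add, map_mul ι a a', map_mul ι a b', add_mul,
    ← mul_assoc]
  abel

lemma fst_mul (x y : D) :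
    fr.fst (x * y) = fr.fst x * fr.fst y + fr.C * fr.snd x * fr.σ (fr.snd y) := by
  conv_lhs => rw [fr.eq_add x, fr.eq_add y, add_mul_add, fst_add]

lemma snd_mul (x y : D) :
    fr.snd (x * y) = fr.fst x * fr.snd y + fr.snd x * fr.σ (fr.fst y) := by
  conv_lhs => rw [fr.eq_add x, fr.eq_add y, add_mul_add, snd_add]

lemma fst_ι (a : L) : fr.fst (ι a) = a := by simpa using fr.fst_add a 0

lemma snd_ι (a : L) : fr.snd (ι a) = 0 := by simpa using fr.snd_add a 0

/-- The reduced norm. -/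
def nrd : D →* L where
  toFun x := fr.fst x * fr.σ (fr.fst x) - fr.C * (fr.snd x * fr.σ (fr.snd x))
  map_one' := by
    have h := map_one ι
    rw [← h, fst_ι, snd_ι]
    simp
  map_mul' x y := by
    rw [fst_mul, snd_mul]
    simp only [map_add, map_mul, σ_σ, σ_C]
    ring

lemma nrd_apply (x : D) :
    fr.nrd x = fr.fst x * fr.σ (fr.fst x) - fr.C * (fr.snd x * fr.σ (fr.snd x)) := rfl

lemma nrd_ι (a : L) : fr.nrd (ι a) = a * fr.σ a := by
  rw [nrd_apply, fst_ι, snd_ι]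
  simp

lemma mul_self (x : D) : x * x = ι (fr.fst x + fr.σ (fr.fst x)) * x - ι (fr.nrd x) := by
  have key : ∀ a b : L, (ι a + ι b * fr.ϖ) * (ι a + ι b * fr.ϖ) =
      ι (a + fr.σ a) * (ι a + ι b * fr.ϖ) - ι (a * fr.σ a - fr.C * (b * fr.σ b)) := by
    intro a b
    rw [add_mul_add, mul_add, ← mul_assoc, ← map_mul, ← map_mul, add_sub_right_comm, ← map_sub]
    congr 3 <;> ring
  have h := key (fr.fst x) (fr.snd x)
  rwa [← fr.eq_add x] at h

lemma norm_C_lt : ‖fr.C‖ < 1 := by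
  rw [C, norm_algebraMap']
  exact fr.norm_c

lemma norm_C_pos : 0 < ‖fr.C‖ := by
  rw [C, norm_algebraMap']
  exact norm_pos_iff.2 fr.c_ne

lemma le_norm_C {a : L} (ha : ‖a‖ < 1) : ‖a‖ ≤ ‖fr.C‖ := by
  obtain ⟨f, hf⟩ := fr.unr a
  rw [hf, C, norm_algebraMap']
  exact fr.le_c f (hf ▸ ha)

lemma norm_ϖ_sq : ‖fr.ϖ‖ ^ 2 = ‖fr.C‖ := by
  rw [sq, ← norm_mul, fr.ϖ_sq, C, norm_algebraMap', norm_algebraMap']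

lemma norm_ϖ_lt : ‖fr.ϖ‖ < 1 := by
  have h1 := fr.norm_ϖ_sq
  have h2 := fr.norm_C_lt
  nlinarith [norm_nonneg fr.ϖ]

lemma norm_ϖ_pos : 0 < ‖fr.ϖ‖ := by
  have h1 := fr.norm_ϖ_sq
  have h2 := fr.norm_C_pos
  by_contra! h
  rw [le_antisymm h (norm_nonneg _)] at h1
  simp at h1
  linarith

/-- The largest value of L below one is |ϖ|², which is smaller than |ϖ|. -/
lemma norm_ϖ_ne (a : L) : ‖a‖ ≠ ‖fr.ϖ‖ := by
  intro h
  have h1 := fr.le_norm_C (h ▸ fr.norm_ϖ_lt)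
  rw [← fr.norm_ϖ_sq, h, sq] at h1
  nlinarith [fr.norm_ϖ_pos, fr.norm_ϖ_lt]

variable [CompleteSpace F] [FiniteDimensional F L]

lemma norm_σ (x : L) : ‖fr.σ x‖ = ‖x‖ := norm_algEquiv fr.σ x

variable [IsUltrametricDist D]

/-- The two summands never have equal nonzero norms, since |ϖ| is not a value of L; the ultrametric
inequality is then an equality. -/
lemma norm_eq_max (x : D) : ‖x‖ = max ‖fr.fst x‖ (‖fr.snd x‖ * ‖fr.ϖ‖) := by
  have hs : ‖ι (fr.snd x) * fr.ϖ‖ = ‖fr.snd x‖ * ‖fr.ϖ‖ := by rw [norm_mul, norm_algHom]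
  by_cases h : fr.snd x = 0
  · conv_lhs => rw [fr.eq_add x, h]
    simp [h, norm_algHom]
  conv_lhs => rw [fr.eq_add x]
  rw [IsUltrametricDist.norm_add_eq_max_of_norm_ne_norm, hs, norm_algHom]
  rw [hs, norm_algHom]
  intro he
  refine fr.norm_ϖ_ne (fr.fst x / fr.snd x) ?_
  rw [norm_div, he, mul_div_cancel_left₀ _ (norm_ne_zero_iff.2 h)]

/-- If the second coordinate b had norm above one, then |b⁻¹| ≤ |ϖ|², so |b||ϖ| ≥ |ϖ|⁻¹ > 1. -/
lemma norm_snd_le_one {x : D} (hx : ‖x‖ ≤ 1) : ‖fr.snd x‖ ≤ 1 := by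
  have h1 : ‖fr.snd x‖ * ‖fr.ϖ‖ ≤ 1 := by
    refine (le_max_right _ _).trans (?_ : max ‖fr.fst x‖ _ ≤ 1)
    rw [← fr.norm_eq_max x]
    exact hx
  by_contra! h
  have h2 := fr.le_norm_C (a := (fr.snd x)⁻¹) (by rw [norm_inv]; exact inv_lt_one_of_one_lt₀ h)
  rw [norm_inv, inv_le_iff_one_le_mul₀ (by linarith), ← fr.norm_ϖ_sq, sq] at h2
  nlinarith [fr.norm_ϖ_pos, fr.norm_ϖ_lt]

lemma norm_fst_eq_one {x : D} (hx : ‖x‖ = 1) : ‖fr.fst x‖ = 1 := by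
  have h := fr.norm_eq_max x
  have h1 := fr.norm_snd_le_one hx.le
  rw [hx] at h
  rcases max_choice ‖fr.fst x‖ (‖fr.snd x‖ * ‖fr.ϖ‖) with h2 | h2
  · rw [← h2, ← h]
  · rw [h2] at h
    nlinarith [fr.norm_ϖ_pos, fr.norm_ϖ_lt]

end Frame

/-! ### Determination of the commutator subgroup -/

namespace Frame

variable {F L D : Type*} [NontriviallyNormedField F] [NormedField L] [NormedAlgebra F L]
  [NormedDivisionRing D] [NormedAlgebra F D] {ι : L →ₐ[F] D} (fr : Frame ι)

/-- The unit `l / σ(l)`. -/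
def ν : L := fr.l / fr.σ fr.l

lemma l_ne : fr.l ≠ 0 := ne_zero_of_norm_eq_one fr.norm_l

lemma σ_ne {a : L} (ha : a ≠ 0) : fr.σ a ≠ 0 := (map_ne_zero_iff _ fr.σ.injective).2 ha

lemma norm_C_mul_lt {x : L} (hx : ‖x‖ ≤ 1) : ‖fr.C * x‖ < 1 :=
  norm_mul_lt_one_of_lt_of_le fr.norm_C_lt hx

lemma exists_algebraMap_add_σ (a : L) : ∃ f, algebraMap F L f = a + fr.σ a :=
  fr.fixed _ (by rw [map_add, σ_σ, add_comm])

variable [CompleteSpace F] [FiniteDimensional F L]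

lemma norm_ν : ‖fr.ν‖ = 1 := by rw [ν, norm_div, fr.norm_σ, fr.norm_l, div_one]

lemma norm_ν_sub : ‖fr.ν - 1‖ = 1 := by
  have : fr.ν - 1 = (fr.l - fr.σ fr.l) / fr.σ fr.l := by
    have := fr.σ_ne fr.l_ne
    rw [ν]
    field_simp
  rw [this, norm_div, fr.norm_l_sub, fr.norm_σ, fr.norm_l, div_one]

lemma norm_mul_σ_le {s : L} (hs : ‖s‖ ≤ 1) : ‖s * fr.σ s‖ ≤ 1 :=
  norm_mul_le_one hs ((fr.norm_σ s).trans_le hs)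

/-- An element of reduced norm one is a commutator if its component in `L` is congruent to one and
has a residually nondegenerate trace. -/
lemma inComm_of_norm_trace_eq [IsUltrametricDist D] {y : D} (hy : fr.nrd y = 1) (hy1 : ‖y - 1‖ < 1)
    (h0 : fr.fst y ≠ 1) (htr : ‖(fr.fst y - 1) + fr.σ (fr.fst y - 1)‖ = ‖fr.fst y - 1‖) :
    InComm y := by
  obtain ⟨w, hw⟩ : ∃ w, w = fr.fst y - 1 := ⟨_, rfl⟩
  rw [← hw] at htr
  have hw0 : w ≠ 0 := hw ▸ sub_ne_zero.2 h0
  obtain ⟨f, hf⟩ := fr.unr w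
  have hfL : ‖algebraMap F L f‖ = ‖w‖ := by rw [norm_algebraMap', hf]
  have hf0 : algebraMap F L f ≠ 0 := by rw [← norm_ne_zero_iff, hfL]; exact norm_ne_zero_iff.2 hw0
  have hσf : fr.σ (algebraMap F L f) = algebraMap F L f := fr.σ.commutes f
  have hσw := fr.σ_ne hw0
  -- `A` is chosen so that Aw = (l − σ(l))f has trace zero: then A and B = Ay have the same trace
  -- and norm, hence the same quadratic equation. Taking |f| = |w| makes `A` a unit, and the trace
  -- hypothesis makes A − σ(A) one.
  obtain ⟨A, hA⟩ : ∃ A, A = (fr.l - fr.σ fr.l) * algebraMap F L f / w := ⟨_, rfl⟩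
  have hσA : fr.σ A = -((fr.l - fr.σ fr.l) * algebraMap F L f) / fr.σ w := by
    rw [hA, map_div₀, map_mul, map_sub, σ_σ, hσf]
    ring
  have hAn : ‖A‖ = 1 := by
    rw [hA, norm_div, norm_mul, hfL, fr.norm_l_sub, one_mul, div_self (norm_ne_zero_iff.2 hw0)]
  have hA0 := ne_zero_of_norm_eq_one hAn
  have hAσ : ‖A - fr.σ A‖ = 1 := by
    have : A - fr.σ A = (fr.l - fr.σ fr.l) * algebraMap F L f * (w + fr.σ w) / (w * fr.σ w) := by
      rw [hσA, hA]; field_simp; ring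
    rw [this, norm_div, norm_mul, norm_mul, norm_mul, fr.norm_σ, htr, hfL, fr.norm_l_sub, one_mul,
      div_self (mul_ne_zero (norm_ne_zero_iff.2 hw0) (norm_ne_zero_iff.2 hw0))]
  obtain ⟨B, hB⟩ : ∃ B, B = ι A * y := ⟨_, rfl⟩
  have hfstB : fr.fst B = A * (1 + w) := by
    rw [hB, fst_mul, fst_ι, snd_ι, hw]; ring
  have htrB : fr.fst B + fr.σ (fr.fst B) = A + fr.σ A := by
    rw [hfstB, map_mul, map_add, map_one, hσA, hA]
    field_simp
    ring
  have hnB : fr.nrd B = A * fr.σ A := by rw [hB, map_mul, hy, mul_one, nrd_ι]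
  have hBB : B * B = ι (A + fr.σ A) * B - ι (A * fr.σ A) := by rw [fr.mul_self, htrB, hnB]
  -- This `x` intertwines A and B = Ay, whence y = A⁻¹xAx⁻¹. It is a unit because it is congruent to
  -- A − σ(A).
  obtain ⟨x, hx⟩ : ∃ x, x = B - ι (fr.σ A) := ⟨_, rfl⟩
  have hxn : ‖x‖ = 1 := by
    have h1 : x = ι (A - fr.σ A) + ι A * (y - 1) := by
      rw [hx, hB, map_sub, mul_sub, mul_one]; abel
    have h2 : ‖ι (A - fr.σ A)‖ = 1 := by rw [norm_algHom, hAσ]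
    rw [← h2]
    refine norm_eq_of_norm_sub_lt ?_
    rw [h1, h2, sub_add_cancel_left, norm_neg]
    exact norm_mul_lt_one (by rw [norm_algHom, hAn]) hy1
  have hBx : B * x = x * ι A := by
    obtain ⟨t, ht⟩ := fr.exists_algebraMap_add_σ A
    have hcomm : ι (A + fr.σ A) * B = B * ι (A + fr.σ A) := by
      rw [← ht, AlgHom.commutes, Algebra.commutes]
    rw [hx, mul_sub, hBB, hcomm, map_add, mul_add, sub_mul, ← map_mul, mul_comm (fr.σ A)]
    abel
  have hιA : ι A ≠ 0 := ne_zero_of_norm_eq_one (by rw [norm_algHom, hAn])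
  refine inComm_of_mul_eq (a := (ι A)⁻¹) (b := x * ι A) (by
    rw [norm_inv, norm_algHom, hAn, inv_one]) (by rw [norm_mul, hxn, norm_algHom, hAn, one_mul]) ?_
  rw [mul_inv_cancel_right₀ hιA, ← hBx, hB, mul_assoc, inv_mul_cancel_left₀ hιA]

variable [IsUltrametricDist L]

lemma norm_one_sub {x : L} (hx : ‖x‖ < 1) : ‖1 - x‖ = 1 := by
  have := norm_eq_of_norm_sub_lt (x := (1 : L)) (y := 1 - x) (by simpa using hx)
  rwa [norm_one] at this

/-- Hensel's lemma for the equation `b (1 - c ν N(s)) = (ν - 1) s`. -/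
lemma exists_eq_mul [ProperSpace L] {b : L} (hb : ‖b‖ ≤ 1) :
    ∃ s : L, ‖s‖ ≤ 1 ∧ b * (1 - fr.C * (fr.ν * (s * fr.σ s))) = (fr.ν - 1) * s := by
  have hσc : Continuous fr.σ := (AddMonoidHomClass.isometry_of_norm fr.σ fr.norm_σ).continuous
  obtain ⟨e, he⟩ : ∃ e : L → L,
    e = fun s => b * (1 - fr.C * (fr.ν * (s * fr.σ s))) - (fr.ν - 1) * s := ⟨_, rfl⟩
  have hec : Continuous e := by rw [he]; fun_prop
  -- Up to multiples of `C`, the error `e` is affine in s with unit slope −(ν − 1). Correcting a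
  -- minimizer by h = e(s)/(ν − 1) shrinks the error by the factor |C| < 1, so the minimum is zero.
  obtain ⟨s, hs, hmin⟩ := (isCompact_closedBall (0 : L) 1).exists_isMinOn ⟨0, by simp⟩
    (f := fun s => ‖e s‖) hec.norm.continuousOn
  have hs1 : ‖s‖ ≤ 1 := by simpa using hs
  refine ⟨s, hs1, sub_eq_zero.1 (?_)⟩
  suffices h : e s = 0 by rwa [he] at h
  by_contra hne
  have hν := fr.norm_ν_sub
  have hν0 := ne_zero_of_norm_eq_one hν
  have hle : ‖e s‖ ≤ 1 := by
    rw [he]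
    refine norm_sub_le_of_le (norm_mul_le_one hb (norm_one_sub (fr.norm_C_mul_lt ?_)).le)
      (norm_mul_le_one hν.le hs1)
    exact norm_mul_le_one fr.norm_ν.le (fr.norm_mul_σ_le hs1)
  obtain ⟨h, hh⟩ : ∃ h, h = e s / (fr.ν - 1) := ⟨_, rfl⟩
  have hhn : ‖h‖ = ‖e s‖ := by rw [hh, norm_div, hν, div_one]
  have hstep : e (s + h) = fr.C * (-(b * fr.ν) * (h * fr.σ s + (s + h) * fr.σ h)) := by
    have h1 : e (s + h) = e s - (fr.ν - 1) * h +
        fr.C * (-(b * fr.ν) * (h * fr.σ s + (s + h) * fr.σ h)) := by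
      rw [he]; simp only [map_add]; ring
    rw [h1, hh, mul_div_cancel₀ _ hν0, sub_self, zero_add]
  have hsh : ‖s + h‖ ≤ 1 := norm_add_le_of_le_of_le hs1 (hhn.trans_le hle)
  have hm : ‖e s‖ ≤ ‖e (s + h)‖ := hmin (a := s + h) (by simpa using hsh)
  have hlt : ‖e (s + h)‖ ≤ ‖fr.C‖ * ‖e s‖ := by
    rw [hstep, norm_mul]
    gcongr
    rw [norm_mul, norm_neg]
    refine (mul_le_of_le_one_left (norm_nonneg _) (norm_mul_le_one hb fr.norm_ν.le)).trans ?_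
    refine norm_add_le_of_le_of_le ?_ ?_
    · rw [norm_mul, fr.norm_σ, hhn]
      exact mul_le_of_le_one_right (norm_nonneg _) hs1
    · rw [norm_mul, fr.norm_σ, hhn]
      exact mul_le_of_le_one_left (norm_nonneg _) hsh
  have h0 : 0 < ‖e s‖ := norm_pos_iff.2 hne
  nlinarith [fr.norm_C_lt]

variable [IsUltrametricDist D]

/-- The commutator of `l` and `1 + s ϖ`. -/
lemma inComm_commutator {s : L} (hs : ‖s‖ ≤ 1) :
    InComm (ι ((1 - fr.C * (fr.ν * (s * fr.σ s))) / (1 - fr.C * (s * fr.σ s))) +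
      ι ((fr.ν - 1) * s / (1 - fr.C * (s * fr.σ s))) * fr.ϖ) := by
  have hq0 : 1 - fr.C * (s * fr.σ s) ≠ 0 :=
    ne_zero_of_norm_eq_one (norm_one_sub (fr.norm_C_mul_lt (fr.norm_mul_σ_le hs)))
  have hb : ‖ι 1 + ι s * fr.ϖ‖ = 1 := by
    rw [fr.norm_eq_max, fst_add, snd_add, norm_one]
    exact max_eq_left (mul_le_one₀ hs (norm_nonneg _) fr.norm_ϖ_lt.le)
  have ha : ‖ι fr.l + ι 0 * fr.ϖ‖ = 1 := by
    rw [map_zero, zero_mul, add_zero, norm_algHom, fr.norm_l]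
  refine inComm_of_mul_eq ha hb ?_
  have hl := fr.σ_ne fr.l_ne
  rw [add_mul_add, add_mul_add, add_mul_add]
  refine congrArg₂ (fun a b => ι a + ι b * fr.ϖ) ?_ ?_
  · simp only [map_mul, map_zero, mul_zero, add_zero, mul_one, one_mul, σ_σ, ν, zero_add]
    generalize hN : 1 - fr.C * (s * fr.σ s) = q at hq0 ⊢
    field_simp
    rw [← hN]
    ring
  · simp only [mul_zero, map_zero, map_one, mul_one, one_mul, add_zero, zero_add, ν]
    generalize hN : 1 - fr.C * (s * fr.σ s) = q at hq0 ⊢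
    field_simp
    rw [← hN]
    ring

/-- The units of the valuation ring of `D` are generated by those of `L` and by commutators. -/
lemma exists_eq_ι_mul (fr : Frame ι) [ProperSpace L] {x : D} (hx : ‖x‖ = 1) :
    ∃ (a : L) (y : D), ‖a‖ = 1 ∧ InComm y ∧ x = ι a * y := by
  have ha := fr.norm_fst_eq_one hx
  have ha0 := ne_zero_of_norm_eq_one ha
  -- Left multiplication by L preserves the ratio of the two coordinates, so `s` is chosen to give
  -- the commutator of `l` and 1 + sϖ the same ratio as `x`.
  obtain ⟨s, hs, h⟩ := fr.exists_eq_mul (b := fr.snd x / fr.fst x) (by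
    rw [norm_div, ha, div_one]
    exact fr.norm_snd_le_one hx.le)
  have hq := norm_one_sub (fr.norm_C_mul_lt (fr.norm_mul_σ_le hs))
  have hp := norm_one_sub (fr.norm_C_mul_lt (norm_mul_le_one fr.norm_ν.le (fr.norm_mul_σ_le hs)))
  have hq0 := ne_zero_of_norm_eq_one hq
  have hp0 := ne_zero_of_norm_eq_one hp
  refine ⟨fr.fst x * (1 - fr.C * (s * fr.σ s)) / (1 - fr.C * (fr.ν * (s * fr.σ s))), _, ?_,
    fr.inComm_commutator hs, ?_⟩
  · rw [norm_div, norm_mul, ha, hq, hp, one_mul, div_one]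
  · rw [← h]
    have key : ∀ a b d : L, ι a * (ι b + ι d * fr.ϖ) = ι (a * b) + ι (a * d) * fr.ϖ :=
      fun a b d => by rw [mul_add, ← mul_assoc, ← map_mul, ← map_mul]
    rw [key]
    conv_lhs => rw [fr.eq_add x]
    generalize 1 - fr.C * (s * fr.σ s) = q at hq0 ⊢
    generalize 1 - fr.C * (fr.ν * (s * fr.σ s)) = r at hp0 ⊢
    refine congrArg₂ (fun a b => ι a + ι b * fr.ϖ) ?_ ?_
    · field_simp
    · field_simp

/-- Elements of `P^1_L` map to the commutator subgroup. -/
lemma inComm_of_norm_eq_one [ProperSpace D] {a : L} (ha : a * fr.σ a = 1) (ha1 : ‖a - 1‖ < 1) :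
    InComm (ι a) := by
  have h1 : ‖(1 : L)‖ ≤ 1 := norm_one.le
  -- The trace criterion fails for ι(a) with a ≠ 1: w = a − 1 has trace −N(w), of norm |w|² < |w|.
  -- Multiplying by the commutator with s = 1 makes the second coordinate b a unit; the new w has
  -- |w| ≤ |C| and trace C·N(b) − N(w), of norm exactly |C|.
  have hy₁ := fr.inComm_commutator h1
  rw [map_one, mul_one, mul_one, mul_one, mul_one] at hy₁
  have hq := norm_one_sub fr.norm_C_lt
  have hq0 := ne_zero_of_norm_eq_one hq
  obtain ⟨a₁, ha₁⟩ : ∃ a₁, a₁ = (1 - fr.C * fr.ν) / (1 - fr.C) := ⟨_, rfl⟩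
  obtain ⟨b₁, hb₁⟩ : ∃ b₁, b₁ = (fr.ν - 1) / (1 - fr.C) := ⟨_, rfl⟩
  rw [← ha₁, ← hb₁] at hy₁
  have hb₁n : ‖b₁‖ = 1 := by rw [hb₁, norm_div, fr.norm_ν_sub, hq, div_one]
  have ha₁n : ‖a₁‖ = 1 := by
    rw [ha₁, norm_div, hq, div_one, norm_one_sub (fr.norm_C_mul_lt fr.norm_ν.le)]
  have ha₁s : ‖a₁ - 1‖ = ‖fr.C‖ := by
    have : a₁ - 1 = -(fr.C * ((fr.ν - 1) / (1 - fr.C))) := by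
      rw [ha₁]; field_simp; ring
    rw [this, norm_neg, norm_mul, ← hb₁, hb₁n, mul_one]
  obtain ⟨y, hy⟩ : ∃ y, y = ι a * (ι a₁ + ι b₁ * fr.ϖ) := ⟨_, rfl⟩
  have han : ‖a‖ = 1 := by
    have := congrArg norm ha
    rw [norm_mul, fr.norm_σ, norm_one, ← sq] at this
    exact (pow_eq_one_iff_of_nonneg (norm_nonneg _) two_ne_zero).1 this
  have hfst : fr.fst y = a * a₁ := by rw [hy, fst_mul, fst_ι, snd_ι, fst_add]; ring
  have hsnd : fr.snd y = a * b₁ := by rw [hy, snd_mul, fst_ι, snd_ι, snd_add]; ring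
  have hnrd : fr.nrd y = 1 := by rw [hy, map_mul, nrd_ι, ha, hy₁.map_eq_one, one_mul]
  have hy1 : ‖y - 1‖ < 1 := by
    have : y - 1 = ι a * ((ι a₁ + ι b₁ * fr.ϖ) - 1) + ι (a - 1) := by
      rw [hy, mul_sub, mul_one, map_sub, map_one]; abel
    rw [this]
    exact norm_add_lt (norm_mul_lt_one (by rw [norm_algHom, han]) hy₁.norm_sub_one_lt)
      (by rwa [norm_algHom])
  obtain ⟨w, hw⟩ : ∃ w, w = fr.fst y - 1 := ⟨_, rfl⟩
  have hwle : ‖w‖ ≤ ‖fr.C‖ := by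
    have : w = (a - 1) * a₁ + (a₁ - 1) := by rw [hw, hfst]; ring
    rw [this]
    refine norm_add_le_of_le_of_le ?_ ha₁s.le
    rw [norm_mul, ha₁n, mul_one]
    exact fr.le_norm_C ha1
  have htr : w + fr.σ w = fr.C * (fr.snd y * fr.σ (fr.snd y)) - w * fr.σ w := by
    rw [nrd_apply] at hnrd
    rw [hw, map_sub, map_one]
    linear_combination hnrd
  have hn1 : ‖fr.C * (fr.snd y * fr.σ (fr.snd y))‖ = ‖fr.C‖ := by
    rw [hsnd, norm_mul, norm_mul, fr.norm_σ, norm_mul, han, hb₁n, mul_one, mul_one, mul_one]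
  have hn2 : ‖w * fr.σ w‖ < ‖fr.C‖ := by
    rw [norm_mul, fr.norm_σ]
    nlinarith [fr.norm_C_lt, fr.norm_C_pos, norm_nonneg w]
  have htrn : ‖w + fr.σ w‖ = ‖fr.C‖ := by
    rw [htr, ← hn1]
    refine norm_eq_of_norm_sub_lt ?_
    rw [sub_sub_cancel, hn1]
    exact hn2
  have hwn : ‖w‖ = ‖fr.C‖ := by
    refine le_antisymm hwle ?_
    rw [← htrn]
    exact norm_add_le_of_le_of_le le_rfl (fr.norm_σ w).le
  have hcomm : InComm y := fr.inComm_of_norm_trace_eq hnrd hy1 (by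
    intro h
    rw [h, sub_self] at hw
    rw [hw, norm_zero] at hwn
    exact fr.norm_C_pos.ne hwn) (by rw [← hw, htrn, hwn])
  have hy₁0 := ne_zero_of_norm_eq_one hy₁.norm_eq
  have : ι a = y * (ι a₁ + ι b₁ * fr.ϖ)⁻¹ := by rw [hy, mul_inv_cancel_right₀ hy₁0]
  rw [this]
  exact hcomm.mul hy₁.inv

/-- The commutator subgroup of the unit group of the valuation ring of `D` consists of the elements
of reduced norm one which are congruent to one. -/
lemma inComm_iff (fr : Frame ι) [ProperSpace L] [ProperSpace D] {x : D} (hx : ‖x‖ = 1) :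
    InComm x ↔ fr.nrd x = 1 ∧ ‖x - 1‖ < 1 := by
  refine ⟨fun h => ⟨h.map_eq_one _, h.norm_sub_one_lt⟩, fun ⟨h1, h2⟩ => ?_⟩
  obtain ⟨a, y, ha, hy, rfl⟩ := fr.exists_eq_ι_mul hx
  refine InComm.mul (fr.inComm_of_norm_eq_one ?_ ?_) hy
  · rwa [map_mul, hy.map_eq_one, mul_one, nrd_ι] at h1
  · rw [← norm_algHom ι (a - 1)]
    have : ι (a - 1) = (ι a * y - 1) - ι a * (y - 1) := by
      rw [map_sub, map_one, mul_sub, mul_one]; abel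
    rw [this]
    exact norm_sub_lt h2 (norm_mul_lt_one (by rw [norm_algHom, ha]) hy.norm_sub_one_lt)

end Frame

/-! ### Profinite quotients and characters of the abelianization -/

section Profinite

/-- The quotient of a profinite group by a closed normal subgroup is totally disconnected. -/
lemma totallyDisconnectedSpace_quotient {G : Type*} [Group G] [TopologicalSpace G]
    [IsTopologicalGroup G] [CompactSpace G] [TotallyDisconnectedSpace G] (N : Subgroup G)
    [N.Normal] [IsClosed (N : Set G)] : TotallyDisconnectedSpace (G ⧸ N) := by
  -- Images of open normal subgroups of `G` are arbitrarily small open subgroups of the quotient,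
  -- which is Hausdorff because `N` is closed.
  have : NonarchimedeanGroup (G ⧸ N) :=
    { is_nonarchimedean := fun U hU => by
        obtain ⟨V, hVU, hV, h1⟩ := mem_nhds_iff.1 hU
        obtain ⟨H, hH⟩ := ProfiniteGrp.exist_openNormalSubgroup_sub_open_nhds_of_one
          (hV.preimage (QuotientGroup.continuous_mk (N := N))) h1
        refine ⟨⟨H.toSubgroup.map (QuotientGroup.mk' N),
          QuotientGroup.isOpenMap_coe _ H.isOpen'⟩, ?_⟩
        rintro _ ⟨x, hx, rfl⟩
        exact hVU (hH hx) }
  infer_instance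

lemma totallyDisconnectedSpace_units_valRing {E : Type*} [NormedDivisionRing E]
    [IsUltrametricDist E] : TotallyDisconnectedSpace (valRing E)ˣ where
  isTotallyDisconnected_univ s _ hs := by
    have hc : Continuous fun u : (valRing E)ˣ => ((u : valRing E) : E) :=
      continuous_subtype_val.comp Units.continuous_val
    intro x hx y hy
    exact unitsVal_injective ((hs.image _ hc.continuousOn).subsingleton ⟨x, hx, rfl⟩ ⟨y, hy, rfl⟩)

/-- The character of the abelianization induced by a character with values in a commutative
group. -/
def abLift {G M : Type*} [Group G] [TopologicalSpace G] [CommGroup M] [TopologicalSpace M]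
    (χ : G →ₜ* M) : Ab G →ₜ* M where
  toMonoidHom := QuotientGroup.lift (commutator G) (χ : G →* M)
    (fun _ hx => Abelianization.commutator_subset_ker (χ : G →* M) hx)
  continuous_toFun := continuous_quot_lift _ χ.continuous_toFun

lemma abLift_mk {G M : Type*} [Group G] [TopologicalSpace G] [CommGroup M] [TopologicalSpace M]
    (χ : G →ₜ* M) (x : G) : abLift χ (QuotientGroup.mk x) = χ x := rfl

/-- Continuous characters of `G` with values in a commutative group, as characters of a group
isomorphic to the abelianization of `G`. -/
def charEquiv {G Q M : Type*} [Group G] [TopologicalSpace G] [Group Q] [TopologicalSpace Q]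
    [CommGroup M] [TopologicalSpace M] [IsTopologicalGroup M] (e : Q ≃ₜ* Ab G) :
    (G →ₜ* M) ≃* (Q →ₜ* M) where
  toFun χ := (abLift χ).comp (e : Q →ₜ* Ab G)
  invFun ψ := (ψ.comp (e.symm : Ab G →ₜ* Q)).comp
    { toMonoidHom := QuotientGroup.mk' (commutator G)
      continuous_toFun := QuotientGroup.continuous_mk }
  left_inv χ := by
    refine ContinuousMonoidHom.ext fun x => ?_
    change abLift χ (e (e.symm (QuotientGroup.mk x))) = χ x
    rw [e.apply_symm_apply, abLift_mk]
  right_inv ψ := by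
    refine ContinuousMonoidHom.ext fun x => ?_
    obtain ⟨y, hy⟩ := QuotientGroup.mk_surjective (e x)
    change abLift _ (e x) = ψ x
    rw [← hy, abLift_mk]
    change ψ (e.symm (QuotientGroup.mk y)) = ψ x
    rw [hy, e.symm_apply_apply]
  map_mul' χ χ' := by
    refine ContinuousMonoidHom.ext fun x => ?_
    obtain ⟨y, hy⟩ := QuotientGroup.mk_surjective (e x)
    change abLift (χ * χ') (e x) = abLift χ (e x) * abLift χ' (e x)
    rw [← hy]
    rfl

lemma charEquiv_apply {G Q M : Type*} [Group G] [TopologicalSpace G]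
    [Group Q] [TopologicalSpace Q] [CommGroup M] [TopologicalSpace M] [IsTopologicalGroup M]
    (e : Q ≃ₜ* Ab G) (χ : G →ₜ* M) {x : Q} {y : G} (h : e x = QuotientGroup.mk y) :
    charEquiv e χ x = χ y := by
  change abLift χ (e x) = _
  rw [h, abLift_mk]

end Profinite

/-! ### The isomorphism with the abelianization -/

section Main

variable {F L D : Type*} [NontriviallyNormedField F] [NormedField L] [NormedAlgebra F L]
  [NormedDivisionRing D] [NormedAlgebra F D] {ι : L →ₐ[F] D}
  [CompleteSpace F] [FiniteDimensional F L] [IsUltrametricDist D] [IsUltrametricDist L]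

lemma mem_commutator_iff {u : (valRing D)ˣ} :
    u ∈ commutator (valRing D)ˣ ↔ InComm ((u : valRing D) : D) :=
  ⟨fun h => ⟨u, h, rfl⟩, fun ⟨_, hv, h⟩ => unitsVal_injective h ▸ hv⟩

/-- The abstract commutator subgroup is closed because its explicit description intersects a level
set of the continuous reduced norm with a closed ball condition. -/
lemma isClosed_commutator [FiniteDimensional F D] [ProperSpace L] [ProperSpace D]
    (fr : Frame ι) : IsClosed (commutator (valRing D)ˣ : Set (valRing D)ˣ) := by
  have hσc : Continuous fr.σ := (AddMonoidHomClass.isometry_of_norm fr.σ fr.norm_σ).continuous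
  have h1 : Continuous fr.fst := LinearMap.continuous_of_finiteDimensional _
  have h2 : Continuous fr.snd := LinearMap.continuous_of_finiteDimensional _
  have h3 : Continuous fr.nrd := by
    change Continuous fun x => fr.fst x * fr.σ (fr.fst x) - fr.C * (fr.snd x * fr.σ (fr.snd x))
    fun_prop
  have hc : Continuous fun u : (valRing D)ˣ => ((u : valRing D) : D) :=
    continuous_subtype_val.comp Units.continuous_val
  have hset : (commutator (valRing D)ˣ : Set (valRing D)ˣ) =
      (fun u : (valRing D)ˣ => ((u : valRing D) : D)) ⁻¹'
        (fr.nrd ⁻¹' {1} ∩ Metric.ball (1 : D) 1) := by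
    ext u
    rw [SetLike.mem_coe, mem_commutator_iff, fr.inComm_iff (norm_coe_units u)]
    simp [dist_eq_norm]
  rw [hset]
  exact ((isClosed_singleton.preimage h3).inter (IsUltrametricDist.isClosed_ball 1 1)).preimage hc

omit [CompleteSpace F] [FiniteDimensional F L] in
lemma mem_P1_iff {u : (valRing L)ˣ} : u ∈ P1 L F ↔
    Algebra.norm F ((u : valRing L) : L) = 1 ∧ ‖((u : valRing L) : L) - 1‖ < 1 := by
  rw [P1, Subgroup.mem_inf, MonoidHom.mem_ker, MonoidHom.mem_ker]
  refine and_congr ?_ ?_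
  · exact Units.ext_iff
  · exact Units.ext_iff.trans Ideal.Quotient.eq

/-- The isomorphism `O_L^× / P^1_L ≅ (O_D^×)^ab`. -/
lemma exists_quotient_equiv [FiniteDimensional F D] [ProperSpace L] [ProperSpace D]
    (fr : Frame ι) (hnorm : ∀ x, algebraMap F L (Algebra.norm F x) = x * fr.σ x) :
    ∃ e : ((valRing L)ˣ ⧸ P1 L F) ≃ₜ* Ab (valRing D)ˣ,
      ∀ u : (valRing L)ˣ, e (QuotientGroup.mk u) = QuotientGroup.mk (unitsEmb ι u) := by
  have hmem : ∀ u, u ∈ P1 L F ↔ unitsEmb ι u ∈ commutator (valRing D)ˣ := by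
    intro u
    rw [mem_P1_iff, mem_commutator_iff, fr.inComm_iff (norm_coe_units _)]
    change _ ↔ fr.nrd (ι ((u : valRing L) : L)) = 1 ∧ ‖ι ((u : valRing L) : L) - 1‖ < 1
    rw [fr.nrd_ι, ← hnorm, map_eq_one_iff _ (algebraMap F L).injective, ← map_one ι, ← map_sub ι,
      norm_algHom]
  let φ : ((valRing L)ˣ ⧸ P1 L F) →* Ab (valRing D)ˣ :=
    QuotientGroup.map (P1 L F) (commutator (valRing D)ˣ) (unitsEmb ι).toMonoidHom
      fun u hu => (hmem u).1 hu
  have hφ : ∀ u : (valRing L)ˣ, φ (QuotientGroup.mk u) = QuotientGroup.mk (unitsEmb ι u) :=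
    fun u => rfl
  have hinj : Function.Injective φ := by
    rw [injective_iff_map_eq_one]
    intro x hx
    obtain ⟨u, rfl⟩ := QuotientGroup.mk_surjective x
    rw [hφ, QuotientGroup.eq_one_iff, ← hmem] at hx
    exact (QuotientGroup.eq_one_iff u).2 hx
  have hsurj : Function.Surjective φ := by
    intro x
    obtain ⟨v, rfl⟩ := QuotientGroup.mk_surjective x
    obtain ⟨a, y, ha, ⟨w, hw, rfl⟩, hv⟩ := fr.exists_eq_ι_mul (norm_coe_units v)
    refine ⟨QuotientGroup.mk (unitOfNorm a ha), ?_⟩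
    rw [hφ, QuotientGroup.eq]
    have : v = unitsEmb ι (unitOfNorm a ha) * w := unitsVal_injective hv
    rw [this, inv_mul_cancel_left]
    exact hw
  have hcont : Continuous φ := continuous_quot_lift _
    (QuotientGroup.continuous_mk.comp (unitsEmb ι).continuous_toFun)
  have hcl : IsClosed (commutator (valRing D)ˣ : Set (valRing D)ˣ) := isClosed_commutator fr
  let e := MulEquiv.ofBijective φ ⟨hinj, hsurj⟩
  let h : ((valRing L)ˣ ⧸ P1 L F) ≃ₜ Ab (valRing D)ˣ :=
    Continuous.homeoOfEquivCompactToT2 (f := e.toEquiv) hcont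
  exact ⟨{ e with
    continuous_toFun := h.continuous_toFun
    continuous_invFun := h.continuous_invFun }, hφ⟩

end Main

/-! ### Comparison of orbits -/

section Orbits

variable {F L D M : Type*} [NontriviallyNormedField F] [NormedField L] [NormedAlgebra F L]
  [NormedDivisionRing D] [NormedAlgebra F D]
  [CompleteSpace F] [FiniteDimensional F L] [IsUltrametricDist D] [IsUltrametricDist L]
  [CommGroup M] [TopologicalSpace M]

/-- Conjugation by `d` acts on characters of `O_L^×` as `τ ∈ Gal(L/F)`. -/
def ActsAs (M : Type*) [CommGroup M] [TopologicalSpace M] (ι : L →ₐ[F] D) (d : Dˣ)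
    (τ : L ≃ₐ[F] L) : Prop :=
  ∀ (χ : (valRing D)ˣ →ₜ* M) (u : (valRing L)ˣ),
    χ (unitsConj d⁻¹ (unitsEmb ι u)) = χ (unitsEmb ι (unitsEmb ((τ⁻¹ : L ≃ₐ[F] L) : L →ₐ[F] L) u))

/-- Here d = ew with w a unit of O_D, and conjugation by w is invisible to characters with
commutative values; so `d` acts as `e` does, namely through τ. -/
lemma actsAs_of_norm_eq {ι : L →ₐ[F] D} {d : Dˣ} {τ : L ≃ₐ[F] L} {e : D} (he : e ≠ 0)
    (h : ∀ x, e * ι x = ι (τ x) * e) (hde : ‖(d : D)‖ = ‖e‖) : ActsAs M ι d τ := by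
  intro χ u
  let w : (valRing D)ˣ := unitOfNorm (e⁻¹ * d) (by
    rw [norm_mul, norm_inv, hde, inv_mul_cancel₀ (norm_ne_zero_iff.2 he)])
  have hw : unitsConj d⁻¹ (unitsEmb ι u) =
      w⁻¹ * unitsEmb ι (unitsEmb ((τ⁻¹ : L ≃ₐ[F] L) : L →ₐ[F] L) u) * w := by
    rw [mul_assoc, eq_inv_mul_iff_mul_eq]
    apply unitsVal_injective
    change e⁻¹ * d * (((d⁻¹ : Dˣ) : D) * ι ((u : valRing L) : L) * ((d⁻¹⁻¹ : Dˣ) : D)) =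
      ι (τ⁻¹ ((u : valRing L) : L)) * (e⁻¹ * d)
    have h1 := h (τ⁻¹ ((u : valRing L) : L))
    have h2 : τ (τ⁻¹ ((u : valRing L) : L)) = ((u : valRing L) : L) :=
      τ.apply_symm_apply _
    rw [h2] at h1
    rw [inv_inv, ← mul_assoc, ← mul_assoc, mul_assoc e⁻¹, Units.mul_inv, mul_one, ← mul_assoc]
    congr 1
    rw [eq_mul_inv_iff_mul_eq₀ he, mul_assoc, ← h1, inv_mul_cancel_left₀ he]
  rw [hw, map_mul, map_mul, mul_comm (χ w⁻¹), mul_assoc, ← map_mul, inv_mul_cancel, map_one,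
    mul_one]

/-- One of the components ι(a) and ι(b)ϖ of `d` has the same norm as `d`; conjugation by it induces
1 or σ on L, respectively. -/
lemma exists_actsAs {ι : L →ₐ[F] D} (fr : Frame ι) (d : Dˣ) : ∃ τ, ActsAs M ι d τ := by
  have hd : ‖(d : D)‖ ≠ 0 := norm_ne_zero_iff.2 d.ne_zero
  have hmax := fr.norm_eq_max (d : D)
  rcases max_choice ‖fr.fst d‖ (‖fr.snd d‖ * ‖fr.ϖ‖) with h | h
  · refine ⟨1, actsAs_of_norm_eq (e := ι (fr.fst d)) ?_ (fun x => ?_) ?_⟩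
    · rw [← norm_ne_zero_iff, norm_algHom, ← h, ← hmax]
      exact hd
    · rw [← map_mul, mul_comm, map_mul]
      rfl
    · rw [norm_algHom, ← h, ← hmax]
  · refine ⟨fr.σ, actsAs_of_norm_eq (e := ι (fr.snd d) * fr.ϖ) ?_ (fun x => ?_) ?_⟩
    · rw [← norm_ne_zero_iff, norm_mul, norm_algHom, ← h, ← hmax]
      exact hd
    · rw [mul_assoc, fr.ϖ_mul, ← mul_assoc, ← mul_assoc, ← map_mul, ← map_mul, mul_comm]
    · rw [norm_mul, norm_algHom, ← h, ← hmax]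

lemma exists_actsAs_of_algEquiv [Algebra.IsCentral F D] (hL : Module.finrank F L = 2)
    (ι : L →ₐ[F] D) (τ : L ≃ₐ[F] L) : ∃ d, ActsAs M ι d τ := by
  obtain ⟨d, hd0, hd⟩ := exists_conj_algHom hL ι (ι.comp (τ : L →ₐ[F] L))
  exact ⟨Units.mk0 d hd0, actsAs_of_norm_eq hd0 (fun x => (hd x).symm) rfl⟩

variable [IsTopologicalGroup M]

lemma ActsAs.map_smul {ι : L →ₐ[F] D} {d : Dˣ} {τ : L ≃ₐ[F] L} (h : ActsAs M ι d τ)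
    {Φ : ((valRing D)ˣ →ₜ* M) ≃* (((valRing L)ˣ ⧸ P1 L F) →ₜ* M)}
    (hΦ : ∀ χ u, Φ χ (QuotientGroup.mk u) = χ (unitsEmb ι u)) (χ : (valRing D)ˣ →ₜ* M) :
    Φ (d • χ) = τ • Φ χ := by
  refine ContinuousMonoidHom.ext fun x => ?_
  obtain ⟨u, rfl⟩ := QuotientGroup.mk_surjective x
  rw [hΦ]
  refine (h χ u).trans ?_
  exact (hΦ χ _).symm

lemma orbitRel_iff [Algebra.IsCentral F D] (hL : Module.finrank F L = 2) {ι : L →ₐ[F] D}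
    (fr : Frame ι) {Φ : ((valRing D)ˣ →ₜ* M) ≃* (((valRing L)ˣ ⧸ P1 L F) →ₜ* M)}
    (hΦ : ∀ χ u, Φ χ (QuotientGroup.mk u) = χ (unitsEmb ι u)) (χ χ' : (valRing D)ˣ →ₜ* M) :
    MulAction.orbitRel Dˣ ((valRing D)ˣ →ₜ* M) χ χ' ↔
      MulAction.orbitRel (L ≃ₐ[F] L) (((valRing L)ˣ ⧸ P1 L F) →ₜ* M) (Φ χ) (Φ χ') := by
  rw [MulAction.orbitRel_apply, MulAction.orbitRel_apply]
  constructor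
  · rintro ⟨d, rfl⟩
    obtain ⟨τ, hτ⟩ := exists_actsAs (M := M) fr d
    exact ⟨τ, (hτ.map_smul hΦ χ').symm⟩
  · rintro ⟨τ, h⟩
    obtain ⟨d, hd⟩ := exists_actsAs_of_algEquiv (M := M) hL ι τ
    exact ⟨d, Φ.injective ((hd.map_smul hΦ χ').trans h)⟩

/-- The map on characters induced by another embedding `L → D` differs by the action of `D^×`. -/
lemma exists_smul_of_algHom [Algebra.IsCentral F D] (hL : Module.finrank F L = 2)
    (ι ι' : L →ₐ[F] D) {Φ Φ' : ((valRing D)ˣ →ₜ* M) ≃* (((valRing L)ˣ ⧸ P1 L F) →ₜ* M)}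
    (hΦ : ∀ χ u, Φ χ (QuotientGroup.mk u) = χ (unitsEmb ι u))
    (hΦ' : ∀ χ u, Φ' χ (QuotientGroup.mk u) = χ (unitsEmb ι' u)) :
    ∃ d : Dˣ, ∀ χ, Φ' χ = Φ (d • χ) := by
  obtain ⟨d, hd0, hd⟩ := exists_conj_algHom hL ι' ι
  refine ⟨Units.mk0 d hd0, fun χ => ContinuousMonoidHom.ext fun x => ?_⟩
  obtain ⟨u, rfl⟩ := QuotientGroup.mk_surjective x
  rw [hΦ, hΦ']
  refine congrArg χ (unitsVal_injective ?_)
  change ι' ((u : valRing L) : L) = (((Units.mk0 d hd0)⁻¹ : Dˣ) : D) * ι ((u : valRing L) : L) *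
    (((Units.mk0 d hd0)⁻¹⁻¹ : Dˣ) : D)
  rw [inv_inv, Units.val_inv_eq_inv_val, Units.val_mk0, mul_assoc, hd, inv_mul_cancel_left₀ hd0]

end Orbits

end LocalQuaternion

/-! ### The theorem -/

open LocalQuaternion
theorem mainTheorem8 (p : ℕ) [Fact p.Prime]
    -- `F` is a finite extension of `ℚ_p`, with the norm extending the `p`-adic norm
    (F : Type*) [NontriviallyNormedField F] [CompleteSpace F]
    [NormedAlgebra ℚ_[p] F] [FiniteDimensional ℚ_[p] F]
    -- `L` is the unramified quadratic extension of `F`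
    (L : Type*) [NormedField L] [IsUltrametricDist L] [NormedAlgebra F L]
    [FiniteDimensional F L] (hL : Module.finrank F L = 2)
    (hunr : LocalQuaternion.IsUnramified L F)
    -- `D` is the quaternion division algebra over `F`
    (D : Type*) [NormedDivisionRing D] [IsUltrametricDist D] [NormedAlgebra F D]
    [Algebra.IsCentral F D] (hD : Module.finrank F D = 4)
    -- `K` is a complete non-archimedean field containing `F`
    (K : Type*) [NormedField K] [CompleteSpace K] [IsUltrametricDist K] [Algebra F K]
    (hK : ‖(p : K)‖ = 1 / p) :
    -- the isomorphism of profinite abelian groups `O_L^× / P^1_L ≅ (O_D^×)^ab`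
    ((CompactSpace (LocalQuaternion.Ab (LocalQuaternion.valRing D)ˣ) ∧
        T2Space (LocalQuaternion.Ab (LocalQuaternion.valRing D)ˣ) ∧
        TotallyDisconnectedSpace (LocalQuaternion.Ab (LocalQuaternion.valRing D)ˣ)) ∧
      ∀ ι : L →ₐ[F] D,
        ∃ e : ((LocalQuaternion.valRing L)ˣ ⧸ LocalQuaternion.P1 L F) ≃ₜ*
            LocalQuaternion.Ab (LocalQuaternion.valRing D)ˣ,
          ∀ u : (LocalQuaternion.valRing L)ˣ,
            e (QuotientGroup.mk u) = QuotientGroup.mk (LocalQuaternion.unitsEmb ι u)) ∧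
    -- the induced isomorphism on continuous characters with values in `K^×`
    ∃ Φ : (L →ₐ[F] D) → (((LocalQuaternion.valRing D)ˣ →ₜ* Kˣ) ≃*
          (((LocalQuaternion.valRing L)ˣ ⧸ LocalQuaternion.P1 L F) →ₜ* Kˣ)),
      (∀ (ι : L →ₐ[F] D) (χ : (LocalQuaternion.valRing D)ˣ →ₜ* Kˣ)
          (u : (LocalQuaternion.valRing L)ˣ),
        Φ ι χ (QuotientGroup.mk u) = χ (LocalQuaternion.unitsEmb ι u)) ∧
      -- the induced bijection on orbits, which is independent of `ι`
      ∃ Ψ : (L →ₐ[F] D) →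
          (MulAction.orbitRel.Quotient Dˣ ((LocalQuaternion.valRing D)ˣ →ₜ* Kˣ) ≃
            MulAction.orbitRel.Quotient (L ≃ₐ[F] L)
              (((LocalQuaternion.valRing L)ˣ ⧸ LocalQuaternion.P1 L F) →ₜ* Kˣ)),
        (∀ (ι : L →ₐ[F] D) (χ : (LocalQuaternion.valRing D)ˣ →ₜ* Kˣ),
          Ψ ι (Quotient.mk _ χ) = Quotient.mk _ (Φ ι χ)) ∧
        ∀ ι ι' : L →ₐ[F] D, Ψ ι = Ψ ι' := by
  have hpF : ProperSpace F := FiniteDimensional.proper ℚ_[p] F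
  have hpL : ProperSpace L := FiniteDimensional.proper F L
  have hfD : FiniteDimensional F D := Module.finite_of_finrank_pos (by omega)
  have hpD : ProperSpace D := FiniteDimensional.proper F D
  have hchar : CharZero F := charZero_of_injective_algebraMap (algebraMap ℚ_[p] F).injective
  have huF : IsUltrametricDist F :=
    IsUltrametricDist.isUltrametricDist_of_forall_norm_add_le_max_norm fun x y => by
      rw [← norm_algebraMap' L x, ← norm_algebraMap' L y, ← norm_algebraMap' L (x + y), map_add]
      exact IsUltrametricDist.norm_add_le_max _ _
  have hquad : Algebra.IsQuadraticExtension F L := ⟨hL⟩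
  obtain ⟨σ, hσ, hinv, hfix, -, hnorm⟩ := exists_involution hL
  obtain ⟨l, hl, hlσ⟩ := exists_norm_sub_eq_one hunr hσ hinv hfix
  have hframe : ∀ ι : L →ₐ[F] D, ∃ fr : Frame ι, fr.σ = σ :=
    nonempty_frame hunr hL hD hl hlσ hinv hfix
  have hequiv : ∀ ι : L →ₐ[F] D, ∃ e : ((valRing L)ˣ ⧸ P1 L F) ≃ₜ* Ab (valRing D)ˣ,
      ∀ u : (valRing L)ˣ, e (QuotientGroup.mk u) = QuotientGroup.mk (unitsEmb ι u) := by
    intro ι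
    obtain ⟨fr, hfr⟩ := hframe ι
    exact exists_quotient_equiv fr (hfr ▸ hnorm)
  choose fr _ using hframe
  refine ⟨⟨?_, hequiv⟩, ?_⟩
  -- Profiniteness is asserted without reference to an embedding, so one has to be produced here.
  · obtain ⟨ι⟩ : Nonempty (L →ₐ[F] D) := nonempty_algHom hL hD hl hlσ hinv hfix
    have hcl : IsClosed (commutator (valRing D)ˣ : Set (valRing D)ˣ) := isClosed_commutator (fr ι)
    have htd : TotallyDisconnectedSpace (valRing D)ˣ := totallyDisconnectedSpace_units_valRing
    exact ⟨inferInstance, inferInstance, totallyDisconnectedSpace_quotient _⟩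
  · choose e he using hequiv
    have hΦ : ∀ (ι : L →ₐ[F] D) (χ : (valRing D)ˣ →ₜ* Kˣ) (u : (valRing L)ˣ),
        charEquiv (e ι) χ (QuotientGroup.mk u) = χ (unitsEmb ι u) :=
      fun ι χ u => charEquiv_apply (e ι) χ (he ι u)
    refine ⟨fun ι => charEquiv (e ι), hΦ, fun ι => Quotient.congr (charEquiv (e ι)).toEquiv
      (orbitRel_iff hL (fr ι) (hΦ ι)), fun ι χ => rfl, fun ι ι' => Equiv.ext fun x => ?_⟩
    induction x using Quotient.inductionOn with
    | h χ =>
      obtain ⟨d, hd⟩ := exists_smul_of_algHom hL ι ι' (hΦ ι) (hΦ ι')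
      refine Quotient.sound ?_
      change MulAction.orbitRel _ _ (charEquiv (e ι) χ) (charEquiv (e ι') χ)
      rw [hd, ← orbitRel_iff hL (fr ι) (hΦ ι)]
      exact Setoid.symm' _ ⟨d, rfl⟩
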